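/- All structures are countable. Let $G$ be a countable group with identity $\epsilon$, let $I,\Lambda$ be countable non-empty sets with distinguished elements $1_I\in I$, $1_\Lambda\in\Lambda$, and let $P=(p_{\lambda,i})$ be a $\Lambda\times I$ matrix over $G$ which is normalised, that is, $p_{1_\Lambda,i}=\epsilon=p_{\lambda,1_I}$ for all $i\in I,\lambda\in\Lambda$. Let $S=\mathcal M[G;I,\Lambda;P]$ be the Rees matrix semigroup, i.e. the set $I\times G\times\Lambda$ with multiplication $(i,g,\lambda)(j,h,\mu)=(i,g\,p_{\lambda,j}\,h,\mu)$. Let $G^P=\{p_{\lambda,i}:\lambda\in\Lambda,\ i\in I\}$, let $P'$ be the $(\Lambda\setminus\{1_\Lambda\})\times(I\setminus\{1_I\})$ submatrix of $P$, and let $C=G^{P'}$ be the set of entries of $P'$. Let $\Gamma(S)$ be the complete bipartite graph with left set $L=\Lambda\setminus\{1_\Lambda\}$ and right set $R=I\setminus\{1_I\}$ in which the edge $(\lambda,i)$ has colour $p_{\lambda,i}\in C$. It is finitely coloured if $C$ is finite. It is of generic type if $|C|\ge 2$, $|L|=|R|=\aleph_0$, and for every map $\alpha$ from a finite subset of $L$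 (respectively of $R$) into $C$ there is a vertex $x\in R$ (respectively $x\in L$) such that for each $y\in\operatorname{dom}\alpha$ the edge joining $x$ and $y$ has colour $\alpha(y)$. A group is homogeneous if every isomorphism between finitely generated subgroups extends to an automorphism of the group. The completely simple semigroup $S$ is homogeneous if every isomorphism between finitely generated completely simple subsemigroups of $S$ extends to an automorphism of $S$; here generation is as unary semigroups, the unary operation sending each element to its inverse in the maximal subgroup containing it. $S$ is orthodox if its idempotents form a subsemigroup. Lemma. Suppose that $\Gamma(S)$ is finitely coloured and not of generic type. Then $S$ is homogeneous if and only if $G$ is homogeneous, the set $G^P$ is a characteristic subgroup of $G$, and one of the following holds: 1. $G^P=\{\epsilon\}$ (in which case $S$ is orthodox); 2. $|I|=|\Lambda|=2$, $G^P=\{\epsilon,a\}\cong\mathbb Z_2$ and $P'=(a)$; 3. $|I|=|\Lambda|=3$, $G^P=\{\epsilon,a,a^{-1}\}\cong\mathbb Z_3$ and, for a suitable ordering of its rows and of its columns, $P'=\begin{pmatrix} a & a^{-1}\\ a^{-1} & a\end{pmatrix}$; 4. $|I|=|\Lambda|=4$, $G^P=\{\epsilon,a\}\cong\mathbb Z_2$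 and, for a suitable ordering of its rows and of its columns, $P'=\begin{pmatrix} \epsilon & a & a\\ a & \epsilon & a\\ a & a & \epsilon\end{pmatrix}$. -/

import Mathlib

/-- The set `X^Q` of entries of a matrix `Q` over `X`. -/
def matrixEntries {Λ I X : Type*} (Q : Matrix Λ I X) : Set X :=
  {x | ∃ l i, Q l i = x}

/-- The Rees matrix semigroup `M[G; I, Λ; P]`: the set `I × G × Λ` of triples, with the
multiplication determined by the sandwich matrix `P` (see the instance below). -/
@[ext]
structure ReesMatrixSemigroup {G I Λ : Type*} (P : Matrix Λ I G) where
  idxI : I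
  val : G
  idxL : Λ

/-- `(i, g, l) (j, h, m) = (i, g * P l j * h, m)`. -/
instance ReesMatrixSemigroup.instMul {G I Λ : Type*} [Group G] (P : Matrix Λ I G) :
    Mul (ReesMatrixSemigroup P) where
  mul x y := ⟨x.idxI, x.val * P x.idxL y.idxI * y.val, y.idxL⟩

theorem ReesMatrixSemigroup.mul_def {G I Λ : Type*} [Group G] {P : Matrix Λ I G}
    (x y : ReesMatrixSemigroup P) :
    x * y = ⟨x.idxI, x.val * P x.idxL y.idxI * y.val, y.idxL⟩ := rfl

instance ReesMatrixSemigroup.instSemigroup {G I Λ : Type*} [Group G] (P : Matrix Λ I G) :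
    Semigroup (ReesMatrixSemigroup P) where
  mul_assoc x y z := by
    simp only [ReesMatrixSemigroup.mul_def, mul_assoc]

/-- The sandwich matrix `P` is normalised along the row `oneL` and the column `oneI`. -/
def IsNormalised {G I Λ : Type*} [Group G] (P : Matrix Λ I G) (oneI : I) (oneL : Λ) : Prop :=
  (∀ i, P oneL i = 1) ∧ ∀ l, P l oneI = 1

/-- The submatrix `P'` of `P` obtained by deleting the row `oneL` and the column `oneI`. -/
def reducedMatrix {G I Λ : Type*} (P : Matrix Λ I G) (oneI : I) (oneL : Λ) :
    Matrix {l : Λ // l ≠ oneL} {i : I // i ≠ oneI} G :=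
  P.submatrix Subtype.val Subtype.val

/-- `Q` is of the form `M`: it becomes `M` after enumerating its rows and its columns. -/
def HasForm {Λ I X : Type*} {r s : ℕ} (Q : Matrix Λ I X) (M : Matrix (Fin r) (Fin s) X) : Prop :=
  ∃ (e : Fin r ≃ Λ) (f : Fin s ≃ I), Q.submatrix e f = M

/-- A `C`-edge-coloured (complete) bipartite graph with left set `L` and right set `R`. -/
structure EdgeColouredBipartiteGraph (L R C : Type*) where
  colour : L → R → C

namespace EdgeColouredBipartiteGraph

variable {L R C : Type*}

/-- `C`-genericity: both sides are countably infinite, and every assignment of colours to a finite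
set of vertices on one side is realised by some vertex on the other side. -/
def IsGeneric (Γ : EdgeColouredBipartiteGraph L R C) : Prop :=
  Cardinal.mk L = Cardinal.aleph0 ∧ Cardinal.mk R = Cardinal.aleph0 ∧
  (∀ (U : Finset L) (α : U → C), ∃ r : R, ∀ l : U, Γ.colour l r = α l) ∧
  (∀ (V : Finset R) (α : V → C), ∃ l : L, ∀ r : V, Γ.colour l r = α r)

/-- Generic type: there are at least two colours and the graph is `C`-generic (a one-coloured
graph is not counted as being of generic type). -/
def IsOfGenericType (Γ : EdgeColouredBipartiteGraph L R C) : Prop :=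
  Nontrivial C ∧ Γ.IsGeneric

/-- Finitely coloured: the set of colours is finite. -/
def IsFinitelyColoured (_Γ : EdgeColouredBipartiteGraph L R C) : Prop :=
  Finite C

end EdgeColouredBipartiteGraph

/-- The edge-coloured bipartite graph `Γ(Q)` of a matrix `Q`; its colours are the entries of `Q`. -/
def matrixGraph {Λ I X : Type*} (Q : Matrix Λ I X) :
    EdgeColouredBipartiteGraph Λ I (matrixEntries Q) where
  colour l i := ⟨Q l i, l, i, rfl⟩

/-- The induced edge-coloured bipartite graph `Γ(S) = Γ(P')` of the Rees matrix semigroup `S` with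
sandwich matrix `P` normalised along the row `oneL` and the column `oneI`. -/
def inducedGraph {G I Λ : Type*} (P : Matrix Λ I G) (oneI : I) (oneL : Λ) :
    EdgeColouredBipartiteGraph {l : Λ // l ≠ oneL} {i : I // i ≠ oneI}
      (matrixEntries (reducedMatrix P oneI oneL)) :=
  matrixGraph (reducedMatrix P oneI oneL)

/-- A group is homogeneous if every isomorphism between finitely generated subgroups extends to an
automorphism. -/
def IsHomogeneousGroup (G : Type*) [Group G] : Prop :=
  ∀ H K : Subgroup G, H.FG → K.FG → ∀ θ : H ≃* K,
    ∃ Θ : G ≃* G, ∀ h : H, Θ (h : G) = (θ h : G)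

/-- `y` is the relative inverse of `x`, i.e. the inverse of `x` in a subgroup of `S` containing it.
(Such a `y` is unique if it exists.) -/
def IsRelativeInverse {S : Type*} [Semigroup S] (x y : S) : Prop :=
  x * y * x = x ∧ y * x * y = y ∧ x * y = y * x

/-- The unary subsemigroup generated by `X`: the least subsemigroup that contains `X` and is closed
under relative inverses. -/
def unaryClosure {S : Type*} [Semigroup S] (X : Set S) : Subsemigroup S :=
  sInf {T | X ⊆ T ∧ ∀ x ∈ T, ∀ y, IsRelativeInverse x y → y ∈ T}

/-- Homogeneity of a completely regular (in particular, of a completely simple) semigroup as a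
unary semigroup: every isomorphism between finitely generated unary subsemigroups extends to an
automorphism. Multiplicative isomorphisms automatically respect relative inverses, and in a
completely simple semigroup the non-empty unary subsemigroups are exactly the completely simple
subsemigroups. -/
def IsHomogeneousCompletelyRegular (S : Type*) [Semigroup S] : Prop :=
  ∀ X Y : Finset S, ∀ φ : unaryClosure (X : Set S) ≃* unaryClosure (Y : Set S),
    ∃ Φ : S ≃* S, ∀ t : unaryClosure (X : Set S), Φ (t : S) = (φ t : S)

/-- A semigroup is orthodox if its idempotents form a subsemigroup. -/
def IsOrthodox (S : Type*) [Semigroup S] : Prop :=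
  ∀ e f : S, IsIdempotentElem e → IsIdempotentElem f → IsIdempotentElem (e * f)

/-! Necessity. Homogeneity is applied only to isomorphisms between boxes `A × H × B` with `A`, `B`
finite and `H` finitely generated, where isomorphisms can be written down. Since there are finitely
many colours, `H` may be the subgroup generated by all entries of `P`. Extending such isomorphisms
shows that `G` is homogeneous, that automorphisms of `G` map entries to entries, and that any finite
partial permutation of the rows extends to a symmetry of `P` up to renormalisation
(`RowExtensible`); the inverse transpose gives the same for columns. Symmetries permuting columns
show that all non-trivial columns have the same multiplicities of entries. Symmetries moving the
distinguished row multiply columns by an entry, so multiplicities are invariant under such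
multiplication (`encard_column_mul`). Hence the entries form a subgroup `H` of some order `n`, and
each entry occurs equally often, say `k` times, in every non-trivial column. Let `H` be non-trivial.
If an index set is infinite, exchanging rows or columns realises every finite pattern and the graph
is of generic type. Otherwise `|Λ| = nk`, and one may assume `|I| ≤ |Λ|`. Every `k`-set of
non-trivial rows is the set of occurrences of a fixed `a ≠ 1` in some column, so `(nk-1).choose k ≤
nk-1`, which forces `k = 1` or `n = k = 2`. If `k = 1`, prescribing the positions of two values
gives `(n-1)(n-2) ≤ n-1`, so `n ≤ 3`. These are the listed matrices
(`finite_classification_of_card_le`). Sufficiency. In the non-trivial cases `P` is `a` raised to a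
bilinear form: multiplication on `ℤ/2` or `ℤ/3`, or the alternating form on `(ℤ/2)²`. Translating
indices changes it only by row and column factors, so automorphisms are transitive on idempotents
and a partial isomorphism may be assumed to fix the distinguished one. It then splits into a partial
isomorphism of `G`, which extends, and partial maps of indices, which extend because `P'` is
determined by a matching of rows with columns (`IsMatching.exists_perm`). -/

namespace ReesMatrixSemigroup

variable {G I Λ : Type*} [Group G] {P : Matrix Λ I G}

/-! ### Arithmetic and automorphisms of a Rees matrix semigroup. -/

@[simp] theorem mul_idxI (x y : ReesMatrixSemigroup P) : (x * y).idxI = x.idxI := rfl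
@[simp] theorem mul_idxL (x y : ReesMatrixSemigroup P) : (x * y).idxL = y.idxL := rfl
@[simp] theorem mul_val (x y : ReesMatrixSemigroup P) :
    (x * y).val = x.val * P x.idxL y.idxI * y.val := rfl

theorem isIdempotentElem_iff (x : ReesMatrixSemigroup P) :
    IsIdempotentElem x ↔ x.val = (P x.idxL x.idxI)⁻¹ := by
  rw [IsIdempotentElem, ReesMatrixSemigroup.ext_iff]
  simp only [mul_idxI, mul_val, mul_idxL, true_and, and_true]
  rw [mul_eq_right, mul_eq_one_iff_eq_inv]

theorem isRelativeInverse_iff (x y : ReesMatrixSemigroup P) :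
    IsRelativeInverse x y ↔
      y = ⟨x.idxI, (P x.idxL x.idxI)⁻¹ * x.val⁻¹ * (P x.idxL x.idxI)⁻¹, x.idxL⟩ := by
  constructor
  · rintro ⟨h₁, -, h₃⟩
    have hI : y.idxI = x.idxI := by simpa using (congrArg idxI h₃).symm
    have hL : y.idxL = x.idxL := by simpa using congrArg idxL h₃
    have hv := congrArg val h₁
    simp only [mul_val, mul_idxL, hI, hL] at hv
    ext
    · exact hI
    · have h : x.val * P x.idxL x.idxI * y.val * (P x.idxL x.idxI * x.val) = 1 * x.val := by
        rw [one_mul, ← mul_assoc]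
        exact hv
      show y.val = _
      rw [← mul_assoc, mul_left_inj, mul_assoc, mul_assoc] at h
      rw [eq_mul_inv_iff_mul_eq, ← mul_inv_rev, eq_inv_iff_mul_eq_one, ← mul_eq_one_comm,
        mul_assoc, h]
    · exact hL
  · rintro rfl
    refine ⟨?_, ?_, ?_⟩ <;> ext <;> simp [mul_assoc]

/-- Being in the same row of the egg-box is expressed by right divisibility. -/
theorem idxI_eq_iff (x y : ReesMatrixSemigroup P) : x.idxI = y.idxI ↔ ∃ z, x * z = y := by
  constructor
  · intro h
    refine ⟨⟨x.idxI, (x.val * P x.idxL x.idxI)⁻¹ * y.val, y.idxL⟩, ?_⟩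
    ext <;> simp [h, mul_assoc]
  · rintro ⟨z, rfl⟩
    rfl

theorem idxL_eq_iff (x y : ReesMatrixSemigroup P) : x.idxL = y.idxL ↔ ∃ z, z * x = y := by
  constructor
  · intro h
    refine ⟨⟨y.idxI, y.val * (P x.idxL x.idxI * x.val)⁻¹, x.idxL⟩, ?_⟩
    ext <;> simp [h, mul_assoc]
  · rintro ⟨z, rfl⟩
    rfl

theorem exists_perm_idxI (Φ : ReesMatrixSemigroup P ≃* ReesMatrixSemigroup P) (l : Λ) :
    ∃ ψ : Equiv.Perm I, ∀ x, (Φ x).idxI = ψ x.idxI := by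
  have key : ∀ (Φ : ReesMatrixSemigroup P ≃* ReesMatrixSemigroup P) (x y),
      x.idxI = y.idxI → (Φ x).idxI = (Φ y).idxI := by
    intro Φ x y h
    obtain ⟨z, rfl⟩ := (idxI_eq_iff x y).1 h
    rw [map_mul, mul_idxI]
  refine ⟨⟨fun i => (Φ ⟨i, 1, l⟩).idxI, fun i => (Φ.symm ⟨i, 1, l⟩).idxI, ?_, ?_⟩, ?_⟩
  · intro i
    exact (key Φ.symm ⟨(Φ ⟨i, 1, l⟩).idxI, 1, l⟩ (Φ ⟨i, 1, l⟩) rfl).trans (by rw [Φ.symm_apply_apply])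
  · intro i
    exact (key Φ ⟨(Φ.symm ⟨i, 1, l⟩).idxI, 1, l⟩ (Φ.symm ⟨i, 1, l⟩) rfl).trans (by rw [Φ.apply_symm_apply])
  · intro x
    exact key Φ _ _ rfl

theorem exists_perm_idxL (Φ : ReesMatrixSemigroup P ≃* ReesMatrixSemigroup P) (i : I) :
    ∃ χ : Equiv.Perm Λ, ∀ x, (Φ x).idxL = χ x.idxL := by
  have key : ∀ (Φ : ReesMatrixSemigroup P ≃* ReesMatrixSemigroup P) (x y),
      x.idxL = y.idxL → (Φ x).idxL = (Φ y).idxL := by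
    intro Φ x y h
    obtain ⟨z, rfl⟩ := (idxL_eq_iff x y).1 h
    rw [map_mul, mul_idxL]
  refine ⟨⟨fun l => (Φ ⟨i, 1, l⟩).idxL, fun l => (Φ.symm ⟨i, 1, l⟩).idxL, ?_, ?_⟩, ?_⟩
  · intro l
    exact (key Φ.symm ⟨i, 1, (Φ ⟨i, 1, l⟩).idxL⟩ (Φ ⟨i, 1, l⟩) rfl).trans (by rw [Φ.symm_apply_apply])
  · intro l
    exact (key Φ ⟨i, 1, (Φ.symm ⟨i, 1, l⟩).idxL⟩ (Φ.symm ⟨i, 1, l⟩) rfl).trans (by rw [Φ.apply_symm_apply])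
  · intro x
    exact key Φ _ _ rfl

theorem isOrthodox (h : ∀ l i, P l i = 1) : IsOrthodox (ReesMatrixSemigroup P) := by
  intro e f he hf
  rw [isIdempotentElem_iff] at *
  simp_all

/-- The automorphism `(i, g, l) ↦ (ψ i, u i * Θ g * v l, χ l)`. -/
def autOfData (Θ : G ≃* G) (ψ : Equiv.Perm I) (χ : Equiv.Perm Λ) (u : I → G) (v : Λ → G)
    (h : ∀ l i, Θ (P l i) = v l * P (χ l) (ψ i) * u i) :
    ReesMatrixSemigroup P ≃* ReesMatrixSemigroup P where
  toFun x := ⟨ψ x.idxI, u x.idxI * Θ x.val * v x.idxL, χ x.idxL⟩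
  invFun x := ⟨ψ.symm x.idxI,
    Θ.symm ((u (ψ.symm x.idxI))⁻¹ * x.val * (v (χ.symm x.idxL))⁻¹), χ.symm x.idxL⟩
  left_inv x := by ext <;> simp [mul_assoc]
  right_inv x := by ext <;> simp [mul_assoc]
  map_mul' x y := by
    ext
    · rfl
    · simp [h, mul_assoc]
    · rfl

section Normalised

variable {oneI : I} {oneL : Λ}

/-- The element `(1, p, 1)`, with `p` the entry at `(l, i)`, is the product of the idempotents `(1,
1, l)` and `(i, 1, 1)`, and an idempotent is determined by its two indices. -/
theorem val_map_entry (hP : IsNormalised P oneI oneL)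
    (Φ : ReesMatrixSemigroup P ≃* ReesMatrixSemigroup P) {ψ : Equiv.Perm I} {χ : Equiv.Perm Λ}
    (hψ : ∀ x, (Φ x).idxI = ψ x.idxI) (hχ : ∀ x, (Φ x).idxL = χ x.idxL) (l : Λ) (i : I) :
    (Φ ⟨oneI, P l i, oneL⟩).val =
      (P (χ l) (ψ oneI))⁻¹ * P (χ l) (ψ i) * (P (χ oneL) (ψ i))⁻¹ := by
  have hmul : (⟨oneI, P l i, oneL⟩ : ReesMatrixSemigroup P) = ⟨oneI, 1, l⟩ * ⟨i, 1, oneL⟩ := by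
    ext <;> simp
  have h₁ : (Φ ⟨oneI, 1, l⟩).val = (P (χ l) (ψ oneI))⁻¹ := by
    have := (isIdempotentElem_iff (Φ ⟨oneI, 1, l⟩)).1
      (IsIdempotentElem.map ((isIdempotentElem_iff _).2 (by simp [hP.2])) Φ)
    rwa [hψ, hχ] at this
  have h₂ : (Φ ⟨i, 1, oneL⟩).val = (P (χ oneL) (ψ i))⁻¹ := by
    have := (isIdempotentElem_iff (Φ ⟨i, 1, oneL⟩)).1
      (IsIdempotentElem.map ((isIdempotentElem_iff _).2 (by simp [hP.1])) Φ)
    rwa [hψ, hχ] at this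
  rw [hmul, map_mul, mul_val, h₁, h₂, hψ, hχ]

/-- The subsemigroup of triples with components in given sets. -/
def box (A : Set I) (H : Subgroup G) (B : Set Λ) (hH : ∀ l ∈ B, ∀ i ∈ A, P l i ∈ H) :
    Subsemigroup (ReesMatrixSemigroup P) where
  carrier := {x | x.idxI ∈ A ∧ x.val ∈ H ∧ x.idxL ∈ B}
  mul_mem' := by
    rintro x y ⟨hxI, hx, hxL⟩ ⟨hyI, hy, hyL⟩
    exact ⟨hxI, H.mul_mem (H.mul_mem hx (hH _ hxL _ hyI)) hy, hyL⟩

theorem mem_box {A : Set I} {H : Subgroup G} {B : Set Λ} {hH : ∀ l ∈ B, ∀ i ∈ A, P l i ∈ H}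
    {x : ReesMatrixSemigroup P} : x ∈ box A H B hH ↔ x.idxI ∈ A ∧ x.val ∈ H ∧ x.idxL ∈ B :=
  Iff.rfl

theorem box_inv_mem {A : Set I} {H : Subgroup G} {B : Set Λ} {hH : ∀ l ∈ B, ∀ i ∈ A, P l i ∈ H}
    {x y : ReesMatrixSemigroup P} (hx : x ∈ box A H B hH) (h : IsRelativeInverse x y) :
    y ∈ box A H B hH := by
  rw [isRelativeInverse_iff] at h
  subst h
  obtain ⟨hI, hv, hL⟩ := hx
  have hp := H.inv_mem (hH _ hL _ hI)
  exact ⟨hI, H.mul_mem (H.mul_mem hp (H.inv_mem hv)) hp, hL⟩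

end Normalised

end ReesMatrixSemigroup

/-! ### Generated unary subsemigroups. -/

section UnaryClosure

variable {S : Type*} [Semigroup S]

theorem subset_unaryClosure (X : Set S) : X ⊆ unaryClosure X := by
  intro x hx
  simp only [unaryClosure, SetLike.mem_coe, Subsemigroup.mem_sInf]
  exact fun T hT => hT.1 hx

theorem unaryClosure_inv_mem {X : Set S} {x y : S} (hx : x ∈ unaryClosure X)
    (h : IsRelativeInverse x y) : y ∈ unaryClosure X := by
  simp only [unaryClosure, Subsemigroup.mem_sInf] at *
  exact fun T hT => hT.2 x (hx T hT) y h

theorem unaryClosure_le {X : Set S} {T : Subsemigroup S} (hX : X ⊆ T)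
    (hT : ∀ x ∈ T, ∀ y, IsRelativeInverse x y → y ∈ T) : unaryClosure X ≤ T :=
  sInf_le ⟨hX, hT⟩

theorem IsRelativeInverse.map {S' : Type*} [Semigroup S'] (α : S ≃* S') {x y : S}
    (h : IsRelativeInverse x y) : IsRelativeInverse (α x) (α y) := by
  obtain ⟨h₁, h₂, h₃⟩ := h
  exact ⟨by simp only [← map_mul, h₁], by simp only [← map_mul, h₂], by simp only [← map_mul, h₃]⟩

theorem map_mem_unaryClosure_image {S' : Type*} [Semigroup S'] (α : S ≃* S') {X : Set S} {x : S}
    (hx : x ∈ unaryClosure X) : α x ∈ unaryClosure (α '' X) := by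
  have : unaryClosure X ≤ (unaryClosure (α '' X)).comap α := by
    refine unaryClosure_le (fun x hx => ?_) (fun x hx y h => ?_)
    · exact subset_unaryClosure _ ⟨x, hx, rfl⟩
    · exact unaryClosure_inv_mem hx (h.map α)
  exact this hx

end UnaryClosure

/-! ### Boxes, and what homogeneity says about them. -/

namespace ReesMatrixSemigroup

variable {G I Λ : Type*} [Group G] {P : Matrix Λ I G} {oneI : I} {oneL : Λ}

/-- By normalisation `(i, g, l) = (i, 1, 1)(1, g, 1)(1, 1, l)`, so finitely many idempotents and
generators of `H` suffice. -/
theorem exists_unaryClosure_eq_box (hP : IsNormalised P oneI oneL) {A : Finset I} {B : Finset Λ}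
    {H : Subgroup G} (hFG : H.FG) (hA : oneI ∈ A) (hB : oneL ∈ B)
    (hH : ∀ l ∈ (B : Set Λ), ∀ i ∈ (A : Set I), P l i ∈ H) :
    ∃ X : Finset (ReesMatrixSemigroup P),
      unaryClosure (X : Set (ReesMatrixSemigroup P)) = box A H B hH := by
  classical
  obtain ⟨F, rfl⟩ := hFG
  set X : Finset (ReesMatrixSemigroup P) := F.image (fun g => ⟨oneI, g, oneL⟩) ∪
    (A.image (fun i => ⟨i, 1, oneL⟩) ∪ B.image (fun l => ⟨oneI, 1, l⟩)) with hX
  refine ⟨X, le_antisymm (unaryClosure_le ?_ fun x hx y h => box_inv_mem hx h) ?_⟩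
  · intro x hx
    simp only [hX, Finset.coe_union, Finset.coe_image, Set.mem_union, Set.mem_image,
      Finset.mem_coe] at hx
    rcases hx with ⟨g, hg, rfl⟩ | ⟨i, hi, rfl⟩ | ⟨l, hl, rfl⟩
    · exact ⟨hA, Subgroup.subset_closure hg, hB⟩
    · exact ⟨hi, one_mem _, hB⟩
    · exact ⟨hA, one_mem _, hl⟩
  · have hI : ∀ i ∈ A, (⟨i, 1, oneL⟩ : ReesMatrixSemigroup P) ∈
        unaryClosure (X : Set (ReesMatrixSemigroup P)) := fun i hi =>
      subset_unaryClosure _ (by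
        simp only [hX, Finset.coe_union, Finset.coe_image]
        exact Or.inr (Or.inl ⟨i, hi, rfl⟩))
    have hL : ∀ l ∈ B, (⟨oneI, 1, l⟩ : ReesMatrixSemigroup P) ∈
        unaryClosure (X : Set (ReesMatrixSemigroup P)) := fun l hl =>
      subset_unaryClosure _ (by
        simp only [hX, Finset.coe_union, Finset.coe_image]
        exact Or.inr (Or.inr ⟨l, hl, rfl⟩))
    have hG : ∀ g ∈ Subgroup.closure (F : Set G), (⟨oneI, g, oneL⟩ : ReesMatrixSemigroup P) ∈
        unaryClosure (X : Set (ReesMatrixSemigroup P)) := by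
      intro g hg
      induction hg using Subgroup.closure_induction with
      | mem g hg =>
        refine subset_unaryClosure _ ?_
        simp only [hX, Finset.coe_union, Finset.coe_image]
        exact Or.inl ⟨g, hg, rfl⟩
      | one => exact hI _ hA
      | mul g h _ _ hg hh =>
        have := mul_mem hg hh
        rwa [mul_def, hP.1, mul_one] at this
      | inv g _ hg =>
        refine unaryClosure_inv_mem hg ((isRelativeInverse_iff _ _).2 ?_)
        ext <;> simp [hP.1]
    rintro ⟨i, g, l⟩ ⟨hi, hg, hl⟩
    have := mul_mem (mul_mem (hI i hi) (hG g hg)) (hL l hl)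
    simpa [mul_def, hP.1] using this

/-- The isomorphism between boxes induced by a group isomorphism and permutations of the indices. -/
noncomputable def boxEquiv {A : Set I} {B : Set Λ} {H H' : Subgroup G} (θ : H ≃* H')
    (ψ : Equiv.Perm I) (χ : Equiv.Perm Λ) (hH : ∀ l ∈ B, ∀ i ∈ A, P l i ∈ H)
    (hH' : ∀ l ∈ χ '' B, ∀ i ∈ ψ '' A, P l i ∈ H')
    (hθ : ∀ l (hl : l ∈ B) i (hi : i ∈ A), (θ ⟨P l i, hH l hl i hi⟩ : G) = P (χ l) (ψ i)) :
    box (P := P) A H B hH ≃* box (P := P) (ψ '' A) H' (χ '' B) hH' where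
  toFun x := ⟨⟨ψ x.1.idxI, θ ⟨x.1.val, x.2.2.1⟩, χ x.1.idxL⟩,
    ⟨_, x.2.1, rfl⟩, (θ _).2, ⟨_, x.2.2.2, rfl⟩⟩
  invFun x := ⟨⟨ψ.symm x.1.idxI, θ.symm ⟨x.1.val, x.2.2.1⟩, χ.symm x.1.idxL⟩,
    (by obtain ⟨i, hi, h⟩ := x.2.1; simpa [← h] using hi), (θ.symm _).2,
    (by obtain ⟨i, hi, h⟩ := x.2.2.2; simpa [← h] using hi)⟩
  left_inv x := by
    apply Subtype.ext
    ext <;> simp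
  right_inv x := by
    apply Subtype.ext
    ext <;> simp
  map_mul' x y := by
    apply Subtype.ext
    ext
    · rfl
    · have h : (⟨(x * y).1.val, (x * y).2.2.1⟩ : H) = ⟨x.1.val, x.2.2.1⟩ *
          ⟨P x.1.idxL y.1.idxI, hH _ x.2.2.2 _ y.2.1⟩ * ⟨y.1.val, y.2.2.1⟩ := rfl
      show (θ ⟨(x * y).1.val, (x * y).2.2.1⟩ : G) = _
      rw [h, map_mul, map_mul, Subgroup.coe_mul, Subgroup.coe_mul, hθ _ x.2.2.2 _ y.2.1]
      rfl
    · rfl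

-- The only gateway from homogeneity to the matrix. The permutations need not fix the distinguished
-- indices, but both boxes must contain them in order to be finitely generated by the previous
-- construction.
open scoped Classical in
theorem exists_aut_extending_boxEquiv (hP : IsNormalised P oneI oneL)
    (hom : IsHomogeneousCompletelyRegular (ReesMatrixSemigroup P)) (A : Finset I) (B : Finset Λ)
    {H H' : Subgroup G} (hFG : H.FG) (θ : H ≃* H') (ψ : Equiv.Perm I) (χ : Equiv.Perm Λ)
    (hA : oneI ∈ A) (hB : oneL ∈ B) (hA' : oneI ∈ A.image ψ) (hB' : oneL ∈ B.image χ)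
    (hH : ∀ l ∈ B, ∀ i ∈ A, P l i ∈ H)
    (hθ : ∀ l (hl : l ∈ B) i (hi : i ∈ A), (θ ⟨P l i, hH l hl i hi⟩ : G) = P (χ l) (ψ i)) :
    ∃ Φ : ReesMatrixSemigroup P ≃* ReesMatrixSemigroup P,
      ∀ i ∈ A, ∀ h : H, ∀ l ∈ B, Φ ⟨i, h, l⟩ = ⟨ψ i, θ h, χ l⟩ := by
  have hFG' : H'.FG := by
    rw [← Group.fg_iff_subgroup_fg] at hFG ⊢
    exact Group.fg_of_surjective (f := θ.toMonoidHom) θ.surjective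
  have hH' : ∀ l ∈ χ '' (B : Set Λ), ∀ i ∈ ψ '' (A : Set I), P l i ∈ H' := by
    rintro _ ⟨l, hl, rfl⟩ _ ⟨i, hi, rfl⟩
    rw [← hθ l hl i hi]
    exact (θ _).2
  obtain ⟨X, hX⟩ := exists_unaryClosure_eq_box hP hFG hA hB hH
  obtain ⟨Y, hY⟩ := exists_unaryClosure_eq_box hP (A := A.image ψ) (B := B.image χ) hFG' hA' hB'
    (by simpa only [Finset.coe_image] using hH')
  have hY' : unaryClosure (Y : Set (ReesMatrixSemigroup P)) =
      box (ψ '' (A : Set I)) H' (χ '' (B : Set Λ)) hH' := by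
    rw [hY]
    ext x
    simp only [mem_box, Finset.coe_image]
  obtain ⟨Φ, hΦ⟩ := hom X Y (((MulEquiv.subsemigroupCongr hX).trans
    (boxEquiv θ ψ χ hH hH' hθ)).trans (MulEquiv.subsemigroupCongr hY').symm)
  refine ⟨Φ, fun i hi h l hl => ?_⟩
  have hmem : (⟨i, h, l⟩ : ReesMatrixSemigroup P) ∈ unaryClosure (X : Set _) := by
    rw [hX]
    exact ⟨hi, h.2, hl⟩
  exact hΦ ⟨_, hmem⟩

theorem isHomogeneousGroup (hP : IsNormalised P oneI oneL)
    (hom : IsHomogeneousCompletelyRegular (ReesMatrixSemigroup P)) : IsHomogeneousGroup G := by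
  intro H K hH _ θ
  obtain ⟨Φ, hΦ⟩ := exists_aut_extending_boxEquiv hP hom {oneI} {oneL} hH θ 1 1
    (by simp) (by simp) (by simp) (by simp) (by simp [hP.1, one_mem])
    (by
      intro l hl i hi
      obtain rfl := Finset.mem_singleton.1 hl
      obtain rfl := Finset.mem_singleton.1 hi
      have : (⟨P l i, by rw [hP.1]; exact one_mem _⟩ : H) = 1 := Subtype.ext (hP.1 _)
      rw [this]
      simp [hP.1])
  have hΦ' : ∀ h : H, Φ ⟨oneI, h, oneL⟩ = ⟨oneI, θ h, oneL⟩ := fun h => by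
    simpa using hΦ oneI (by simp) h oneL (by simp)
  have hone : Φ ⟨oneI, 1, oneL⟩ = ⟨oneI, 1, oneL⟩ := by simpa using hΦ' 1
  have hone' : Φ.symm ⟨oneI, 1, oneL⟩ = ⟨oneI, 1, oneL⟩ := by
    rw [MulEquiv.symm_apply_eq, hone]
  -- An automorphism fixing the idempotent `e = (1, 1, 1)` preserves the maximal subgroup `eSe`, a
  -- copy of `G`.
  have key : ∀ Ψ : ReesMatrixSemigroup P ≃* ReesMatrixSemigroup P,
      Ψ ⟨oneI, 1, oneL⟩ = ⟨oneI, 1, oneL⟩ → ∀ g, Ψ ⟨oneI, g, oneL⟩ =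
        ⟨oneI, (Ψ ⟨oneI, g, oneL⟩).val, oneL⟩ := by
    intro Ψ hΨ g
    have h : (⟨oneI, g, oneL⟩ : ReesMatrixSemigroup P) =
        ⟨oneI, 1, oneL⟩ * ⟨oneI, g, oneL⟩ * ⟨oneI, 1, oneL⟩ := by
      ext <;> simp [hP.1]
    have h' := congrArg Ψ h
    rw [map_mul, map_mul, hΨ] at h'
    ext
    · rw [h']; rfl
    · rfl
    · rw [h']; rfl
  refine ⟨⟨⟨fun g => (Φ ⟨oneI, g, oneL⟩).val, fun g => (Φ.symm ⟨oneI, g, oneL⟩).val, ?_, ?_⟩,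
    ?_⟩, ?_⟩
  · intro g
    show (Φ.symm ⟨oneI, (Φ ⟨oneI, g, oneL⟩).val, oneL⟩).val = g
    rw [← key Φ hone, Φ.symm_apply_apply]
  · intro g
    show (Φ ⟨oneI, (Φ.symm ⟨oneI, g, oneL⟩).val, oneL⟩).val = g
    rw [← key Φ.symm hone', Φ.apply_symm_apply]
  · intro g h
    have hm : (⟨oneI, g * h, oneL⟩ : ReesMatrixSemigroup P) =
        ⟨oneI, g, oneL⟩ * ⟨oneI, h, oneL⟩ := by
      ext <;> simp [hP.1]
    show (Φ ⟨oneI, g * h, oneL⟩).val = _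
    rw [hm, map_mul, key Φ hone g, key Φ hone h]
    simp [hP.1]
  · intro h
    exact congrArg val (hΦ' h)

/-- Every automorphism of `G` is realised on the entries of `P` by permutations of the indices. -/
theorem exists_perm_of_mulEquiv (hP : IsNormalised P oneI oneL)
    (hom : IsHomogeneousCompletelyRegular (ReesMatrixSemigroup P))
    (hfin : (matrixEntries P).Finite) (Θ : G ≃* G) :
    ∃ (ψ : Equiv.Perm I) (χ : Equiv.Perm Λ), ∀ l i, Θ (P l i) = P (χ l) (ψ i) := by
  have hFG : (Subgroup.closure (matrixEntries P)).FG := ⟨hfin.toFinset, by simp⟩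
  obtain ⟨Φ, hΦ⟩ := exists_aut_extending_boxEquiv hP hom {oneI} {oneL} hFG
    (Θ.subgroupMap (Subgroup.closure (matrixEntries P))) 1 1
    (by simp) (by simp) (by simp) (by simp) (by simp [hP.1, one_mem])
    (by
      intro l hl i hi
      obtain rfl := Finset.mem_singleton.1 hl
      obtain rfl := Finset.mem_singleton.1 hi
      simp [hP.1])
  obtain ⟨ψ, hψ⟩ := exists_perm_idxI Φ oneL
  obtain ⟨χ, hχ⟩ := exists_perm_idxL Φ oneI
  refine ⟨ψ, χ, fun l i => ?_⟩
  have h := hΦ oneI (by simp) ⟨P l i, Subgroup.subset_closure ⟨l, i, rfl⟩⟩ oneL (by simp)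
  have h₁ : ψ oneI = oneI := by
    rw [← hψ ⟨oneI, P l i, oneL⟩, h]; rfl
  have h₂ : χ oneL = oneL := by
    rw [← hχ ⟨oneI, P l i, oneL⟩, h]; rfl
  have h₃ := val_map_entry hP Φ hψ hχ l i
  rw [h, h₁, h₂, hP.1, hP.2] at h₃
  simpa using h₃

end ReesMatrixSemigroup

/-! ### Row and column symmetries of the sandwich matrix. -/

/-- Every finite partial permutation of the rows extends to a permutation of the rows after which,
up to normalisation along the image of the row `oneL`, the columns are only permuted. -/
def RowExtensible {G I Λ : Type*} [Group G] (P : Matrix Λ I G) (oneI : I) (oneL : Λ) : Prop :=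
  ∀ (B : Finset Λ) (f : Equiv.Perm Λ), ∃ (χ : Equiv.Perm Λ) (ψ : Equiv.Perm I),
    (∀ l ∈ B, χ l = f l) ∧ ψ oneI = oneI ∧ ∀ l i, P l i = P (χ l) (ψ i) * (P (χ oneL) (ψ i))⁻¹

/-- The sandwich matrix of the opposite of a Rees matrix semigroup. -/
def invTranspose {G I Λ : Type*} [Group G] (P : Matrix Λ I G) : Matrix I Λ G :=
  fun i l => (P l i)⁻¹

namespace ReesMatrixSemigroup

variable {G I Λ : Type*} [Group G] {P : Matrix Λ I G} {oneI : I} {oneL : Λ}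

/-- A box with the single column index `oneI` involves only trivial entries of `P`, so any row
permutation together with the identity on the group part is an isomorphism. Since the group part
contains all entries, the extension leaves the group component of each `(1, p, 1)` unchanged, and
`val_map_entry` gives the relation. -/
theorem rowExtensible (hP : IsNormalised P oneI oneL)
    (hom : IsHomogeneousCompletelyRegular (ReesMatrixSemigroup P))
    (hfin : (matrixEntries P).Finite) : RowExtensible P oneI oneL := by
  classical
  intro B f
  have hFG : (Subgroup.closure (matrixEntries P)).FG := ⟨hfin.toFinset, by simp⟩
  obtain ⟨Φ, hΦ⟩ := exists_aut_extending_boxEquiv hP hom {oneI}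
    -- Including `f.symm oneL` puts `oneL` in the target box.
    (insert oneL (insert (f.symm oneL) B)) hFG (MulEquiv.refl _) 1 f
    (by simp) (by simp) (by simp) (by simp)
    (fun l _ i _ => Subgroup.subset_closure ⟨l, i, rfl⟩)
    (by
      intro l hl i hi
      obtain rfl := Finset.mem_singleton.1 hi
      simp [hP.2])
  obtain ⟨ψ, hψ⟩ := exists_perm_idxI Φ oneL
  obtain ⟨χ, hχ⟩ := exists_perm_idxL Φ oneI
  have hψ1 : ψ oneI = oneI := by
    rw [← hψ ⟨oneI, (1 : Subgroup.closure (matrixEntries P)), oneL⟩, hΦ _ (by simp) _ _ (by simp)]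
    rfl
  refine ⟨χ, ψ, fun l hl => ?_, hψ1, fun l i => ?_⟩
  · rw [← hχ ⟨oneI, (1 : Subgroup.closure (matrixEntries P)), l⟩,
      hΦ _ (by simp) _ _ (by simp [hl])]
  · have h := hΦ oneI (by simp) ⟨P l i, Subgroup.subset_closure ⟨l, i, rfl⟩⟩ oneL (by simp)
    have h₃ := val_map_entry hP Φ hψ hχ l i
    rw [h, hψ1, hP.2] at h₃
    simpa using h₃

/-- Permuting columns produces a correction factor on the left; inversion moves it to the right, so
that the row arguments apply verbatim to columns. -/
theorem rowExtensible_invTranspose (hP : IsNormalised P oneI oneL)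
    (hom : IsHomogeneousCompletelyRegular (ReesMatrixSemigroup P))
    (hfin : (matrixEntries P).Finite) : RowExtensible (invTranspose P) oneL oneI := by
  classical
  intro A f
  have hFG : (Subgroup.closure (matrixEntries P)).FG := ⟨hfin.toFinset, by simp⟩
  obtain ⟨Φ, hΦ⟩ := exists_aut_extending_boxEquiv hP hom
    (insert oneI (insert (f.symm oneI) A)) {oneL} hFG (MulEquiv.refl _) f 1
    (by simp) (by simp) (by simp) (by simp)
    (fun l _ i _ => Subgroup.subset_closure ⟨l, i, rfl⟩)
    (by
      intro l hl i hi
      obtain rfl := Finset.mem_singleton.1 hl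
      simp [hP.1])
  obtain ⟨ψ, hψ⟩ := exists_perm_idxI Φ oneL
  obtain ⟨χ, hχ⟩ := exists_perm_idxL Φ oneI
  have hχ1 : χ oneL = oneL := by
    rw [← hχ ⟨oneI, (1 : Subgroup.closure (matrixEntries P)), oneL⟩, hΦ _ (by simp) _ _ (by simp)]
    rfl
  refine ⟨ψ, χ, fun i hi => ?_, hχ1, fun i l => ?_⟩
  · rw [← hψ ⟨i, (1 : Subgroup.closure (matrixEntries P)), oneL⟩,
      hΦ _ (by simp [hi]) _ _ (by simp)]
  · have h := hΦ oneI (by simp) ⟨P l i, Subgroup.subset_closure ⟨l, i, rfl⟩⟩ oneL (by simp)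
    have h₃ := val_map_entry hP Φ hψ hχ l i
    rw [h, hχ1, hP.1] at h₃
    have h₄ : P l i = (P (χ l) (ψ oneI))⁻¹ * P (χ l) (ψ i) := by simpa using h₃
    simp [invTranspose, h₄]

end ReesMatrixSemigroup

section InvTranspose

variable {G I Λ : Type*} [Group G] {P : Matrix Λ I G} {oneI : I} {oneL : Λ}

theorem invTranspose_apply (P : Matrix Λ I G) (i : I) (l : Λ) : invTranspose P i l = (P l i)⁻¹ :=
  rfl

theorem invTranspose_invTranspose (P : Matrix Λ I G) : invTranspose (invTranspose P) = P := by
  funext l i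
  exact inv_inv _

theorem IsNormalised.invTranspose (hP : IsNormalised P oneI oneL) :
    IsNormalised (invTranspose P) oneL oneI :=
  ⟨fun l => by rw [invTranspose_apply, hP.2, inv_one],
    fun i => by rw [invTranspose_apply, hP.1, inv_one]⟩

theorem mem_matrixEntries_invTranspose {x : G} :
    x ∈ matrixEntries (invTranspose P) ↔ x⁻¹ ∈ matrixEntries P := by
  constructor
  · rintro ⟨i, l, rfl⟩
    exact ⟨l, i, (inv_inv _).symm⟩
  · rintro ⟨l, i, h⟩
    exact ⟨i, l, by rw [invTranspose_apply, h, inv_inv]⟩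

theorem finite_matrixEntries_invTranspose (h : (matrixEntries P).Finite) :
    (matrixEntries (invTranspose P)).Finite := by
  refine (h.image (·⁻¹)).subset fun x hx => ?_
  exact ⟨x⁻¹, mem_matrixEntries_invTranspose.1 hx, inv_inv x⟩

end InvTranspose

/-! ### Multiplicities of entries in columns; the entries form a subgroup. -/

section Columns

variable {G I Λ : Type*} [Group G] {P : Matrix Λ I G} {oneI : I} {oneL : Λ}

theorem one_mem_matrixEntries (hP : IsNormalised P oneI oneL) : (1 : G) ∈ matrixEntries P :=
  ⟨oneL, oneI, hP.1 _⟩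

theorem RowExtensible.exists_fixing (hP : IsNormalised P oneI oneL) (hr : RowExtensible P oneI oneL)
    (B : Finset Λ) (f : Equiv.Perm Λ) (hf : f oneL = oneL) :
    ∃ (χ : Equiv.Perm Λ) (ψ : Equiv.Perm I), (∀ l ∈ B, χ l = f l) ∧ χ oneL = oneL ∧
      ψ oneI = oneI ∧ ∀ l i, P l i = P (χ l) (ψ i) := by
  classical
  obtain ⟨χ, ψ, hχ, hψ, h⟩ := hr (insert oneL B) f
  have h₁ : χ oneL = oneL := by rw [hχ _ (by simp), hf]
  refine ⟨χ, ψ, fun l hl => hχ l (by simp [hl]), h₁, hψ, fun l i => ?_⟩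
  rw [h l i, h₁, hP.1, inv_one, mul_one]

/-- The group of colour preserving automorphisms is transitive on the columns. -/
theorem exists_perm_column (hP : IsNormalised P oneI oneL)
    (hc : RowExtensible (invTranspose P) oneL oneI) {i j : I} (hi : i ≠ oneI) (hj : j ≠ oneI) :
    ∃ χ : Equiv.Perm Λ, χ oneL = oneL ∧ ∀ l, P l i = P (χ l) j := by
  classical
  obtain ⟨ψ, χ, hψ, -, hχ, h⟩ := hc.exists_fixing hP.invTranspose {i} (Equiv.swap i j)
    (Equiv.swap_apply_of_ne_of_ne hi.symm hj.symm)
  refine ⟨χ, hχ, fun l => ?_⟩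
  have := h i l
  rw [hψ i (by simp), Equiv.swap_apply_left] at this
  exact inv_injective this

theorem encard_column_eq (hP : IsNormalised P oneI oneL)
    (hc : RowExtensible (invTranspose P) oneL oneI) {i j : I} (hi : i ≠ oneI) (hj : j ≠ oneI)
    (x : G) : {l | P l i = x}.encard = {l | P l j = x}.encard := by
  obtain ⟨χ, -, h⟩ := exists_perm_column hP hc hi hj
  have : {l | P l j = x} = χ '' {l | P l i = x} := by
    ext l
    simp [h]
  rw [this, χ.injective.encard_image]

theorem exists_row_of_mem_matrixEntries (hP : IsNormalised P oneI oneL)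
    (hc : RowExtensible (invTranspose P) oneL oneI) {j : I} (hj : j ≠ oneI) {x : G}
    (hx : x ∈ matrixEntries P) : ∃ l, P l j = x := by
  obtain ⟨l, i, rfl⟩ := hx
  by_cases hi : i = oneI
  · exact ⟨oneL, by rw [hi, hP.1, hP.2]⟩
  · obtain ⟨χ, -, h⟩ := exists_perm_column hP hc hi hj
    exact ⟨χ l, (h l).symm⟩

/-- Move the distinguished row to a row `l₀` where column `j` has entry `y`. Renormalising shows
that column `j` is, after permuting rows, the column `ψ.symm j` multiplied by `y` on the right, and
these two columns have equal multiplicities. -/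
theorem encard_column_mul (hP : IsNormalised P oneI oneL) (hr : RowExtensible P oneI oneL)
    (hc : RowExtensible (invTranspose P) oneL oneI) {j : I} (hj : j ≠ oneI) (x : G) {y : G}
    (hy : y ∈ matrixEntries P) : {l | P l j = x * y}.encard = {l | P l j = x}.encard := by
  classical
  obtain ⟨l₀, rfl⟩ := exists_row_of_mem_matrixEntries hP hc hj hy
  obtain ⟨χ, ψ, hχ, hψ, h⟩ := hr {oneL} (Equiv.swap oneL l₀)
  have hχ1 : χ oneL = l₀ := by rw [hχ _ (by simp), Equiv.swap_apply_left]
  have hi : ψ.symm j ≠ oneI := by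
    rw [Ne, Equiv.symm_apply_eq, hψ]
    exact hj
  have hset : {l | P l j = x * P l₀ j} = χ '' {l | P l (ψ.symm j) = x} := by
    ext l
    rw [Equiv.image_eq_preimage_symm, Set.mem_preimage, Set.mem_ofPred_eq, Set.mem_ofPred_eq,
      h (χ.symm l), Equiv.apply_symm_apply, Equiv.apply_symm_apply, hχ1, mul_inv_eq_iff_eq_mul]
  rw [hset, χ.injective.encard_image, encard_column_eq hP hc hi hj]

theorem encard_column_eq_one (hP : IsNormalised P oneI oneL) (hr : RowExtensible P oneI oneL)
    (hc : RowExtensible (invTranspose P) oneL oneI) {j : I} (hj : j ≠ oneI) {x : G}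
    (hx : x ∈ matrixEntries P) : {l | P l j = x}.encard = {l | P l j = 1}.encard := by
  rw [← one_mul x, encard_column_mul hP hr hc hj 1 hx]

theorem mem_matrixEntries_iff_encard (hP : IsNormalised P oneI oneL)
    (hc : RowExtensible (invTranspose P) oneL oneI) {j : I} (hj : j ≠ oneI) {x : G} :
    x ∈ matrixEntries P ↔ {l | P l j = x}.encard ≠ 0 := by
  rw [Set.encard_ne_zero]
  exact ⟨fun hx => exists_row_of_mem_matrixEntries hP hc hj hx, fun ⟨l, hl⟩ => ⟨l, j, hl⟩⟩

theorem exists_subgroup_eq_matrixEntries (hP : IsNormalised P oneI oneL)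
    (hr : RowExtensible P oneI oneL) (hc : RowExtensible (invTranspose P) oneL oneI) :
    ∃ H : Subgroup G, (H : Set G) = matrixEntries P := by
  by_cases hI : ∃ j, j ≠ oneI
  · obtain ⟨j, hj⟩ := hI
    refine ⟨⟨⟨⟨matrixEntries P, ?_⟩, one_mem_matrixEntries hP⟩, ?_⟩, rfl⟩
    · intro x y hx hy
      rw [mem_matrixEntries_iff_encard hP hc hj] at hx ⊢
      rwa [encard_column_mul hP hr hc hj x hy]
    · intro x hx
      change x ∈ matrixEntries P at hx
      change x⁻¹ ∈ matrixEntries P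
      -- The multiplicity of `x⁻¹` equals that of `x⁻¹ * x = 1`, which is not zero.
      rw [mem_matrixEntries_iff_encard hP hc hj, ← encard_column_mul hP hr hc hj _ hx,
        inv_mul_cancel, ← mem_matrixEntries_iff_encard hP hc hj]
      exact one_mem_matrixEntries hP
  · push Not at hI
    refine ⟨⊥, Set.Subset.antisymm ?_ ?_⟩
    · rintro _ rfl
      exact one_mem_matrixEntries hP
    · rintro _ ⟨l, i, rfl⟩
      rw [hI i, hP.2]
      rfl

end Columns

/-! ### Infinitely many indices force generic type. -/

section Infinite

variable {G I Λ : Type*} [Group G] {P : Matrix Λ I G} {oneI : I} {oneL : Λ}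

theorem infinite_column [Infinite Λ] (hP : IsNormalised P oneI oneL)
    (hr : RowExtensible P oneI oneL) (hc : RowExtensible (invTranspose P) oneL oneI)
    (hfin : (matrixEntries P).Finite) {j : I} (hj : j ≠ oneI) {x : G}
    (hx : x ∈ matrixEntries P) : {l | P l j = x}.Infinite := by
  intro hx'
  refine Set.infinite_univ (α := Λ) ((hfin.biUnion (t := fun x => {l | P l j = x})
    fun y hy => ?_).subset fun l _ => ?_)
  · rw [← Set.encard_lt_top_iff, encard_column_eq_one hP hr hc hj hy,
      ← encard_column_eq_one hP hr hc hj hx, Set.encard_lt_top_iff]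
    exact hx'
  · exact Set.mem_biUnion (x := P l j) ⟨l, j, rfl⟩ rfl

/-- If there are infinitely many rows, every finite pattern occurs in some column. -/
theorem exists_column_of_pattern [Infinite Λ] (hP : IsNormalised P oneI oneL)
    (hr : RowExtensible P oneI oneL) (hc : RowExtensible (invTranspose P) oneL oneI)
    (hfin : (matrixEntries P).Finite) (hI : ∃ j, j ≠ oneI) (U : Finset Λ) (hU : oneL ∉ U)
    (α : Λ → G) (hα : ∀ l ∈ U, α l ∈ matrixEntries P) :
    ∃ j, j ≠ oneI ∧ ∀ l ∈ U, P l j = α l := by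
  classical
  induction U using Finset.induction_on with
  | empty => simpa using hI
  | insert m U hm ih =>
    simp only [Finset.mem_insert, not_or, forall_eq_or_imp] at hU hα ⊢
    obtain ⟨j, hj, hjU⟩ := ih hU.2 hα.2
    obtain ⟨m', hm', hm'U⟩ :=
      (infinite_column hP hr hc hfin hj hα.1).exists_notMem_finset (insert oneL U)
    simp only [Finset.mem_insert, not_or] at hm'U
    -- Row `m'` lies outside `U` and already has the value wanted at `m`; exchanging the two rows
    -- leaves the pattern on `U` intact.
    obtain ⟨χ, ψ, hχ, -, hψ, h⟩ := hr.exists_fixing hP (insert m' U) (Equiv.swap m' m)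
      (Equiv.swap_apply_of_ne_of_ne (Ne.symm hm'U.1) hU.1)
    refine ⟨ψ j, ?_, ?_, fun l hl => ?_⟩
    · rw [← hψ]
      exact ψ.injective.ne hj
    · rw [← hm', h m' j, hχ m' (by simp), Equiv.swap_apply_left]
    · rw [← hjU l hl, h l j, hχ l (by simp [hl]), Equiv.swap_apply_of_ne_of_ne]
      · rintro rfl
        exact hm'U.2 hl
      · rintro rfl
        exact hm hl

theorem infinite_columns [Infinite Λ] (hP : IsNormalised P oneI oneL)
    (hr : RowExtensible P oneI oneL) (hc : RowExtensible (invTranspose P) oneL oneI)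
    (hfin : (matrixEntries P).Finite) {a : G} (ha : a ∈ matrixEntries P) (ha1 : a ≠ 1) :
    Infinite I := by
  classical
  by_contra hI
  rw [not_infinite_iff_finite] at hI
  have := Fintype.ofFinite I
  have hj : ∃ j, j ≠ oneI := by
    obtain ⟨l, i, rfl⟩ := ha
    refine ⟨i, ?_⟩
    rintro rfl
    exact ha1 (hP.2 l)
  obtain ⟨U, hU, hcard⟩ := (Set.Finite.infinite_compl
    (Set.finite_singleton oneL)).exists_subset_card_eq (Fintype.card I + 1)
  -- The indicator patterns of the points of `U` need `|I| + 1` different columns.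
  have hpat : ∀ u : U, ∃ j, ∀ l ∈ U, P l j = if l = u then a else 1 := by
    intro u
    obtain ⟨j, -, h⟩ := exists_column_of_pattern hP hr hc hfin hj U (fun h => hU h rfl)
      (fun l => if l = u then a else 1) (by
        intro l _
        split_ifs
        · exact ha
        · exact one_mem_matrixEntries hP)
    exact ⟨j, h⟩
  choose r hr' using hpat
  have hinj : Function.Injective r := by
    intro u v huv
    by_contra hne
    have h₁ := hr' u u u.2
    have h₂ := hr' v u u.2
    rw [if_pos rfl] at h₁
    rw [if_neg (fun h => hne (Subtype.ext h)), ← huv, h₁] at h₂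
    exact ha1 h₂
  have := Fintype.card_le_of_injective r hinj
  simp [hcard] at this

theorem isOfGenericType [Countable I] [Countable Λ] [Infinite I] [Infinite Λ]
    (hP : IsNormalised P oneI oneL) (hr : RowExtensible P oneI oneL)
    (hc : RowExtensible (invTranspose P) oneL oneI) (hfin : (matrixEntries P).Finite) {a : G}
    (ha : a ∈ matrixEntries P) (ha1 : a ≠ 1) : (inducedGraph P oneI oneL).IsOfGenericType := by
  classical
  obtain ⟨j₀, hj₀⟩ := exists_ne oneI
  -- Infinite multiplicity makes every entry, including `1`, occur off the distinguished row, so `P`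
  -- and `P'` have the same entries.
  have hcol : ∀ {x : G}, x ∈ matrixEntries P → x ∈ matrixEntries (reducedMatrix P oneI oneL) := by
    intro x hx
    obtain ⟨l, hl, hl1⟩ :=
      (infinite_column hP hr hc hfin hj₀ hx).exists_notMem_finset {oneL}
    exact ⟨⟨l, by simpa using hl1⟩, ⟨j₀, hj₀⟩, hl⟩
  have hcol' : ∀ {x : G}, x ∈ matrixEntries (reducedMatrix P oneI oneL) → x ∈ matrixEntries P := by
    rintro _ ⟨l, i, rfl⟩
    exact ⟨l, i, rfl⟩
  have hL : Infinite {l : Λ // l ≠ oneL} :=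
    (Set.Finite.infinite_compl (Set.finite_singleton oneL)).to_subtype
  have hI : Infinite {i : I // i ≠ oneI} :=
    (Set.Finite.infinite_compl (Set.finite_singleton oneI)).to_subtype
  refine ⟨⟨⟨1, hcol (one_mem_matrixEntries hP)⟩, ⟨a, hcol ha⟩, fun h => ha1 ?_⟩,
    Cardinal.mk_eq_aleph0 _, Cardinal.mk_eq_aleph0 _, fun U α => ?_, fun V α => ?_⟩
  · exact (congrArg Subtype.val h).symm
  · have hinj : Function.Injective (fun u : U => (u : Λ)) :=
      Subtype.val_injective.comp Subtype.val_injective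
    obtain ⟨j, hj, h⟩ := exists_column_of_pattern hP hr hc hfin ⟨j₀, hj₀⟩
      (U.map ⟨_, Subtype.val_injective⟩) (by simp)
      (Function.extend (fun u : U => (u : Λ)) (fun u => (α u : G)) 1) (by
        intro l hl
        obtain ⟨u, hu, rfl⟩ := Finset.mem_map.1 hl
        exact (hinj.extend_apply (fun u => (α u : G)) 1 ⟨u, hu⟩).symm ▸ hcol' (α ⟨u, hu⟩).2)
    refine ⟨⟨j, hj⟩, fun l => Subtype.ext ?_⟩
    refine (h l (Finset.mem_map_of_mem _ l.2)).trans ?_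
    exact hinj.extend_apply (fun u => (α u : G)) 1 l
  · have hinj : Function.Injective (fun u : V => (u : I)) :=
      Subtype.val_injective.comp Subtype.val_injective
    obtain ⟨l₀, hl₀⟩ := exists_ne oneL
    -- The pattern on columns is realised in the inverse transpose, so its colours have to be
    -- inverted.
    obtain ⟨l, hl, h⟩ := exists_column_of_pattern hP.invTranspose hc
      (by rwa [invTranspose_invTranspose]) (finite_matrixEntries_invTranspose hfin) ⟨l₀, hl₀⟩
      (V.map ⟨_, Subtype.val_injective⟩) (by simp)
      (Function.extend (fun u : V => (u : I)) (fun u => (α u : G)⁻¹) 1) (by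
        intro i hi
        obtain ⟨u, hu, rfl⟩ := Finset.mem_map.1 hi
        refine (hinj.extend_apply (fun u => (α u : G)⁻¹) 1 ⟨u, hu⟩).symm ▸ ?_
        rw [mem_matrixEntries_invTranspose, inv_inv]
        exact hcol' (α ⟨u, hu⟩).2)
    refine ⟨⟨l, hl⟩, fun r => Subtype.ext (inv_injective ?_)⟩
    refine (h r (Finset.mem_map_of_mem _ r.2)).trans ?_
    exact hinj.extend_apply (fun u => (α u : G)⁻¹) 1 r

end Infinite

/-! ### A binomial bound, and matchings between rows and columns. -/

theorem Nat.lt_choose {m k : ℕ} (hk : 2 ≤ k) (hkm : k + 2 ≤ m) : m < m.choose k := by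
  induction m generalizing k with
  | zero => omega
  | succ m ih =>
    obtain ⟨k, rfl⟩ : ∃ k', k = k' + 1 := ⟨k - 1, by omega⟩
    rw [Nat.choose_succ_succ']
    have hpos : 0 < m.choose (k + 1) := Nat.choose_pos (by omega)
    rcases Nat.lt_or_ge 1 k with h | h
    · have := ih (k := k) h (by omega)
      omega
    · obtain rfl : k = 1 := by omega
      rw [Nat.choose_one_right, show 1 + 1 = 2 from rfl]
      rcases Nat.lt_or_ge m 4 with h4 | h4
      · obtain rfl : m = 3 := by omega
        decide
      · have := ih (k := 2) le_rfl (by omega)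
        omega

/-- For `k ≥ 2` the previous bound gives `nk - 1 < k + 2`; with `n ≥ 2` this leaves only `k = 2` and
`n = 2`. -/
theorem Nat.eq_one_or_of_choose_le {n k : ℕ} (hn : 2 ≤ n) (hk : 1 ≤ k)
    (h : (n * k - 1).choose k ≤ n * k - 1) : k = 1 ∨ (n = 2 ∧ k = 2) := by
  rcases Nat.lt_or_ge 1 k with hk' | hk'
  · right
    have hlt : n * k - 1 < k + 2 := by
      by_contra! hcon
      exact absurd (Nat.lt_choose hk' hcon) (by omega)
    have h2 : 2 * k ≤ n * k := Nat.mul_le_mul_right k hn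
    have hk2 : k = 2 := by omega
    subst hk2
    omega
  · left
    omega

/-- A column with a single `x` off the distinguished row determines the row of that `x`, so the
choice of columns is injective; `|I| ≤ |Λ|` makes it bijective. -/
theorem exists_equiv_of_matching {G I Λ : Type*} {P : Matrix Λ I G} {oneI : I} {oneL : Λ}
    [Finite Λ] [Finite I] (hle : Nat.card I ≤ Nat.card Λ) {x : G}
    (h : ∀ l' : {l : Λ // l ≠ oneL}, ∃ j : {i : I // i ≠ oneI},
      ∀ l : {l : Λ // l ≠ oneL}, P l j = x ↔ l = l') :
    ∃ r : {l : Λ // l ≠ oneL} ≃ {i : I // i ≠ oneI},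
      ∀ l l' : {l : Λ // l ≠ oneL}, P l (r l') = x ↔ l = l' := by
  classical
  have := Fintype.ofFinite Λ
  have := Fintype.ofFinite I
  choose r hr using h
  have hinj : Function.Injective r := by
    intro l l' hll
    have h₁ := (hr l l).2 rfl
    rw [hll] at h₁
    exact (hr l' l).1 h₁
  have hbij : Function.Bijective r := by
    rw [Fintype.bijective_iff_injective_and_card]
    refine ⟨hinj, le_antisymm (Fintype.card_le_of_injective _ hinj) ?_⟩
    rw [Nat.card_eq_fintype_card, Nat.card_eq_fintype_card] at hle
    simpa [Fintype.card_subtype_compl] using Nat.sub_le_sub_right hle 1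
  refine ⟨Equiv.ofBijective r hbij, fun l l' => ?_⟩
  exact hr l' l

/-- A matrix with the entry `x` exactly along a matching of rows and columns. -/
theorem exists_matching_form {G I Λ : Type*} {P : Matrix Λ I G} {oneI : I} {oneL : Λ} [Finite Λ] 
    {m : ℕ} (hm : Nat.card Λ = m + 1) {x y : G}
    (r : {l : Λ // l ≠ oneL} ≃ {i : I // i ≠ oneI})
    (hx : ∀ l l' : {l : Λ // l ≠ oneL}, P l (r l') = x ↔ l = l')
    (hy : ∀ l l' : {l : Λ // l ≠ oneL}, l ≠ l' → P l (r l') = y)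
    {M : Matrix (Fin m) (Fin m) G} (hM : ∀ s t, M s t = if s = t then x else y) :
    HasForm (reducedMatrix P oneI oneL) M := by
  classical
  have := Fintype.ofFinite Λ
  have hc : Fintype.card {l : Λ // l ≠ oneL} = m := by
    rw [Nat.card_eq_fintype_card] at hm
    simp [Fintype.card_subtype_compl, hm]
  let e := (Fintype.equivFinOfCardEq hc).symm
  refine ⟨e, e.trans r, ?_⟩
  funext s t
  show P (e s) (r (e t)) = M s t
  rw [hM]
  split_ifs with h
  · rw [hx, h]
  · exact hy _ _ (e.injective.ne h)

/-! ### Classification of the matrices with finitely many indices. -/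

section Finite

variable {G I Λ : Type*} [Group G] {P : Matrix Λ I G} {oneI : I} {oneL : Λ}

theorem RowExtensible.exists_perm_fixing [Finite Λ] (hP : IsNormalised P oneI oneL)
    (hr : RowExtensible P oneI oneL) (f : Equiv.Perm Λ) (hf : f oneL = oneL) :
    ∃ ψ : Equiv.Perm I, ψ oneI = oneI ∧ ∀ l i, P l i = P (f l) (ψ i) := by
  classical
  have := Fintype.ofFinite Λ
  obtain ⟨χ, ψ, hχ, -, hψ, h⟩ := hr.exists_fixing hP Finset.univ f hf
  exact ⟨ψ, hψ, fun l i => by rw [← hχ l (by simp), ← h]⟩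

open scoped Classical in
/-- Every non-trivial column contains every entry of `P` equally often. -/
theorem exists_card_column [Fintype Λ] (hP : IsNormalised P oneI oneL)
    (hr : RowExtensible P oneI oneL) (hc : RowExtensible (invTranspose P) oneL oneI)
    (hI : ∃ j, j ≠ oneI) {H : Subgroup G} (hH : (H : Set G) = matrixEntries P) :
    ∃ k, 1 ≤ k ∧ Fintype.card Λ = Nat.card H * k ∧
      ∀ j, j ≠ oneI → ∀ x ∈ H, (Finset.univ.filter fun l => P l j = x).card = k := by
  obtain ⟨j₀, hj₀⟩ := hI
  have hcard : ∀ j, j ≠ oneI → ∀ x ∈ H, (Finset.univ.filter fun l => P l j = x).card =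
      (Finset.univ.filter fun l => P l j₀ = 1).card := by
    intro j hj x hx
    have hx' : x ∈ matrixEntries P := hH ▸ hx
    have h := encard_column_eq_one hP hr hc hj hx'
    rw [encard_column_eq hP hc hj hj₀ 1] at h
    have e : ∀ j x, {l | P l j = x} =
        ((Finset.univ.filter fun l => P l j = x : Finset Λ) : Set Λ) := by
      intro j x
      ext
      simp
    rw [e, e, Set.encard_coe_eq_coe_finsetCard, Set.encard_coe_eq_coe_finsetCard] at h
    exact_mod_cast h
  have hfinH : (H : Set G).Finite := by
    refine (Set.finite_range fun l => P l j₀).subset fun x hx => ?_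
    rw [hH] at hx
    exact exists_row_of_mem_matrixEntries hP hc hj₀ hx
  refine ⟨_, ?_, ?_, hcard⟩
  · exact Finset.card_pos.2 ⟨oneL, by simp [hP.1]⟩
  · have h := Finset.card_eq_sum_card_fiberwise (s := Finset.univ) (t := hfinH.toFinset)
      (f := fun l => P l j₀) (fun l _ => by
        rw [Set.Finite.coe_toFinset, hH]
        exact ⟨l, j₀, rfl⟩)
    rw [Finset.sum_congr rfl (fun x hx => hcard j₀ hj₀ x (hfinH.mem_toFinset.1 hx)),
      Finset.sum_const, smul_eq_mul, Finset.card_univ] at h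
    rw [h, ← Set.ncard_eq_toFinset_card _ hfinH]
    rfl

open scoped Classical in
/-- Every set of rows of the right size is the set of occurrences of `a` in some column. -/
theorem exists_column_filter_eq [Fintype Λ] (hP : IsNormalised P oneI oneL)
    (hr : RowExtensible P oneI oneL) {j : I} (hj : j ≠ oneI) {a : G} (ha1 : a ≠ 1) (B : Finset Λ)
    (hB : oneL ∉ B) (hcard : (Finset.univ.filter fun l => P l j = a).card = B.card) :
    ∃ j', j' ≠ oneI ∧ ∀ l, P l j' = a ↔ l ∈ B := by
  obtain ⟨σ, hσ⟩ := Equiv.Perm.exists_map_finset_eq _ _ hcard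
  have hmem : ∀ l, P l j = a ↔ σ l ∈ B := by
    intro l
    rw [← hσ]
    simp
  have hσ1 : σ oneL ∉ B := by
    rw [← hmem, hP.1]
    exact Ne.symm ha1
  -- The permutation `σ` may move `oneL`. Neither `σ oneL` nor `oneL` is in `B`, so swapping them
  -- repairs this without disturbing `B`.
  obtain ⟨ψ, hψ, h⟩ := hr.exists_perm_fixing hP (σ.trans (Equiv.swap (σ oneL) oneL)) (by simp)
  refine ⟨ψ j, by rw [← hψ]; exact ψ.injective.ne hj, fun l => ?_⟩
  obtain ⟨l, rfl⟩ := (σ.trans (Equiv.swap (σ oneL) oneL)).surjective l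
  rw [← h, hmem, Equiv.trans_apply]
  by_cases h₁ : σ l = σ oneL
  · rw [h₁, Equiv.swap_apply_left]
    exact iff_of_false hσ1 hB
  · by_cases h₂ : σ l = oneL
    · rw [h₂, Equiv.swap_apply_right]
      exact iff_of_false hB hσ1
    · rw [Equiv.swap_apply_of_ne_of_ne h₁ h₂]

theorem card_eq_of_matching [Finite Λ] [Finite I]
    (r : {l : Λ // l ≠ oneL} ≃ {i : I // i ≠ oneI}) : Nat.card I = Nat.card Λ := by
  classical
  have := Fintype.ofFinite Λ
  have := Fintype.ofFinite I
  have h := Fintype.card_congr r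
  have hL := Fintype.card_pos_iff.2 ⟨oneL⟩
  have hI := Fintype.card_pos_iff.2 ⟨oneI⟩
  simp only [ne_eq, Fintype.card_subtype_compl, Fintype.card_unique] at h
  rw [Nat.card_eq_fintype_card, Nat.card_eq_fintype_card]
  omega

theorem Subgroup.coe_eq_pair {H : Subgroup G} (h : Nat.card H = 2) {a : G} (ha : a ∈ H)
    (ha1 : a ≠ 1) : (H : Set G) = {1, a} := by
  refine (Set.eq_of_subset_of_ncard_le ?_ ?_ ?_).symm
  · rintro _ (rfl | rfl)
    exacts [H.one_mem, ha]
  · rw [Set.ncard_pair ha1.symm]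
    exact h.le
  · exact Set.finite_of_ncard_ne_zero (by rw [show (H : Set G).ncard = 2 from h]; simp)

theorem Subgroup.coe_eq_triple {H : Subgroup G} (h : Nat.card H = 3) {a : G} (ha : a ∈ H)
    (ha1 : a ≠ 1) : (H : Set G) = {1, a, a⁻¹} := by
  have h3 : a ^ 3 = 1 := by
    have := pow_card_eq_one' (x := (⟨a, ha⟩ : H))
    rw [h] at this
    exact congrArg Subtype.val this
  have hne : a ≠ a⁻¹ := by
    intro h'
    have h2 : a * a = 1 := by
      nth_rewrite 2 [h']
      exact mul_inv_cancel a
    rw [pow_succ, pow_two, h2, one_mul] at h3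
    exact ha1 h3
  have hc : ({1, a, a⁻¹} : Set G).ncard = 3 := by
    rw [Set.ncard_eq_three]
    exact ⟨1, a, a⁻¹, ha1.symm, fun h => ha1 (inv_eq_one.1 h.symm), hne, rfl⟩
  refine (Set.eq_of_subset_of_ncard_le ?_ ?_ ?_).symm
  · rintro _ (rfl | rfl | rfl)
    exacts [H.one_mem, ha, H.inv_mem ha]
  · rw [hc]
    exact h.le
  · exact Set.finite_of_ncard_ne_zero (by rw [show (H : Set G).ncard = 3 from h]; simp)

theorem Subgroup.nonempty_mulEquiv_zmod {H : Subgroup G} {p : ℕ} [Fact p.Prime]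
    (h : Nat.card H = p) : Nonempty (H ≃* Multiplicative (ZMod p)) :=
  ⟨mulEquivOfPrimeCardEq (p := p) h (by simp)⟩

-- Two-row patterns of a column can be transported to any two non-trivial rows; this is the input of
-- the count bounding the order of `H`.
open scoped Classical in
theorem exists_column_pair [Fintype Λ] (hP : IsNormalised P oneI oneL)
    (hr : RowExtensible P oneI oneL) {j : I} (hj : j ≠ oneI) {l₁ l₂ m₁ m₂ : Λ}
    (hl₁ : l₁ ≠ oneL) (hl₂ : l₂ ≠ oneL) (hl : l₁ ≠ l₂)
    (hm₁ : m₁ ≠ oneL) (hm₂ : m₂ ≠ oneL) (hm : m₁ ≠ m₂) :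
    ∃ j', j' ≠ oneI ∧ P m₁ j' = P l₁ j ∧ P m₂ j' = P l₂ j := by
  have hinj : ∀ {a b c : Λ}, a ≠ b → a ≠ c → b ≠ c → Function.Injective ![a, b, c] := by
    intro a b c hab hac hbc s t hst
    fin_cases s <;> fin_cases t <;> simp_all
  obtain ⟨σ, hσ⟩ := Equiv.Perm.exists_extending_pair ![oneL, l₁, l₂] ![oneL, m₁, m₂]
    (hinj hl₁.symm hl₂.symm hl) (hinj hm₁.symm hm₂.symm hm)
  obtain ⟨ψ, hψ, h⟩ := hr.exists_perm_fixing hP σ (hσ 0)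
  refine ⟨ψ j, by rw [← hψ]; exact ψ.injective.ne hj, ?_, ?_⟩
  · rw [h l₁ j]
    exact congrArg (fun l => P l (ψ j)) (hσ 1).symm
  · rw [h l₂ j]
    exact congrArg (fun l => P l (ψ j)) (hσ 2).symm

-- Fix two values of a column in distinct non-trivial rows. For every ordered pair of distinct
-- non-trivial rows some column has these values there, and as no value repeats in a column, the
-- column determines the pair. So `(n-1)(n-2) ≤ n-1`, where `n = |H|`.
open scoped Classical in
theorem card_subgroup_le_three [Fintype Λ] [Fintype I] (hP : IsNormalised P oneI oneL)
    (hr : RowExtensible P oneI oneL) (hle : Fintype.card I ≤ Fintype.card Λ) {H : Subgroup G}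
    (hmem : ∀ l i, P l i ∈ H)
    (hI : ∃ j, j ≠ oneI) (hcardΛ : Fintype.card Λ = Nat.card H)
    (hone : ∀ j, j ≠ oneI → ∀ x ∈ H, (Finset.univ.filter fun l => P l j = x).card = 1) :
    Nat.card H ≤ 3 := by
  obtain ⟨j₀, hj₀⟩ := hI
  by_contra! hlt
  have hcL : Fintype.card {l : Λ // l ≠ oneL} = Nat.card H - 1 := by
    simp [Fintype.card_subtype_compl, hcardΛ]
  have hcR : Fintype.card {i : I // i ≠ oneI} ≤ Nat.card H - 1 := by
    rw [← hcardΛ]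
    simpa [Fintype.card_subtype_compl] using Nat.sub_le_sub_right hle 1
  obtain ⟨l₁, l₂, hl⟩ := Fintype.one_lt_card_iff.1
    (show 1 < Fintype.card {l : Λ // l ≠ oneL} by omega)
  have hpair : ∀ p : (Finset.univ.offDiag : Finset ({l : Λ // l ≠ oneL} × {l : Λ // l ≠ oneL})),
      ∃ j : {i : I // i ≠ oneI}, P p.1.1 j = P l₁ j₀ ∧ P p.1.2 j = P l₂ j₀ := by
    intro p
    obtain ⟨j, hj, h⟩ := exists_column_pair hP hr hj₀ l₁.2 l₂.2 (Subtype.val_injective.ne hl)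
      p.1.1.2 p.1.2.2 (Subtype.val_injective.ne (Finset.mem_offDiag.1 p.2).2.2)
    exact ⟨⟨j, hj⟩, h⟩
  choose r hr₁ hr₂ using hpair
  have huniq : ∀ (j : {i : I // i ≠ oneI}) (l m m' : Λ), P m j = P l j₀ → P m' j = P l j₀ →
      m = m' := fun j l m m' h h' =>
    Finset.card_le_one.1 (hone j j.2 (P l j₀) (hmem _ _)).le m (by simpa using h) m'
      (by simpa using h')
  have hinj : Function.Injective r := by
    intro p q hpq
    refine Subtype.ext (Prod.ext (Subtype.ext ?_) (Subtype.ext ?_))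
    · exact huniq (r q) l₁ _ _ (hpq ▸ hr₁ p) (hr₁ q)
    · exact huniq (r q) l₂ _ _ (hpq ▸ hr₂ p) (hr₂ q)
  have hle' := Fintype.card_le_of_injective r hinj
  rw [Fintype.card_coe, Finset.offDiag_card, Finset.card_univ, hcL] at hle'
  obtain ⟨m, hm⟩ : ∃ m, Nat.card H - 1 = m + 3 := ⟨Nat.card H - 4, by omega⟩
  rw [hm] at hle' hcR
  have : (m + 3) * (m + 3) ≤ (m + 3) + (m + 3) := by omega
  nlinarith

/-- The classification of the possible sandwich matrices when there are finitely many indices. -/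
theorem finite_classification_of_card_le [Finite Λ] [Finite I] (hP : IsNormalised P oneI oneL)
    (hr : RowExtensible P oneI oneL) (hc : RowExtensible (invTranspose P) oneL oneI)
    (hle : Nat.card I ≤ Nat.card Λ) {H : Subgroup G} (hH : (H : Set G) = matrixEntries P)
    {a : G} (ha : a ∈ H) (ha1 : a ≠ 1) :
    Nat.card I = Nat.card Λ ∧
    ((Nat.card I = 2 ∧ Nat.card Λ = 2 ∧ Nonempty (H ≃* Multiplicative (ZMod 2)) ∧
        ∃ a : G, (H : Set G) = {1, a} ∧
          HasForm (reducedMatrix P oneI oneL) !![a]) ∨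
     (Nat.card I = 3 ∧ Nat.card Λ = 3 ∧ Nonempty (H ≃* Multiplicative (ZMod 3)) ∧
        ∃ a : G, (H : Set G) = {1, a, a⁻¹} ∧
          HasForm (reducedMatrix P oneI oneL) !![a, a⁻¹; a⁻¹, a]) ∨
     (Nat.card I = 4 ∧ Nat.card Λ = 4 ∧ Nonempty (H ≃* Multiplicative (ZMod 2)) ∧
        ∃ a : G, (H : Set G) = {1, a} ∧
          HasForm (reducedMatrix P oneI oneL) !![1, a, a; a, 1, a; a, a, 1])) := by
  classical
  have := Fintype.ofFinite Λ
  have := Fintype.ofFinite I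
  have hmem : ∀ l i, P l i ∈ H := fun l i => by
    rw [← SetLike.mem_coe, hH]
    exact ⟨l, i, rfl⟩
  have hI : ∃ j, j ≠ oneI := by
    obtain ⟨l, i, h⟩ : a ∈ matrixEntries P := hH ▸ ha
    refine ⟨i, ?_⟩
    rintro rfl
    exact ha1 (by rw [← h, hP.2])
  obtain ⟨k, hk, hcard, hcol⟩ := exists_card_column hP hr hc hI hH
  obtain ⟨j₀, hj₀⟩ := hI
  have hcardΛ : Nat.card Λ = Nat.card H * k := by rw [Nat.card_eq_fintype_card, hcard]
  have hΛpos : 0 < Nat.card Λ := Nat.card_pos_iff.2 ⟨⟨oneL⟩, inferInstance⟩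
  have hn : 2 ≤ Nat.card H := by
    have : Finite H := Nat.finite_of_card_ne_zero (by
      rintro h
      rw [h, zero_mul] at hcardΛ
      omega)
    have : Nontrivial H := ⟨⟨a, ha⟩, 1, fun h => ha1 (congrArg Subtype.val h)⟩
    exact Finite.one_lt_card
  have hset : ∀ B : Finset {l : Λ // l ≠ oneL}, B.card = k →
      ∃ j : {i : I // i ≠ oneI}, ∀ l : {l : Λ // l ≠ oneL}, P l j = a ↔ l ∈ B := by
    intro B hB
    obtain ⟨j, hj, h⟩ := exists_column_filter_eq hP hr hj₀ ha1
      (B.map ⟨_, Subtype.val_injective⟩) (by simp) (by rw [hcol _ hj₀ _ ha, Finset.card_map, hB])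
    refine ⟨⟨j, hj⟩, fun l => ?_⟩
    rw [h]
    simp
  have hcL : Fintype.card {l : Λ // l ≠ oneL} = Nat.card H * k - 1 := by
    rw [← hcard]
    simp [Fintype.card_subtype_compl]
  have hcR : Fintype.card {i : I // i ≠ oneI} ≤ Nat.card H * k - 1 := by
    rw [← hcardΛ]
    simpa [Fintype.card_subtype_compl] using Nat.sub_le_sub_right hle 1
  -- Distinct `k`-sets of rows are the sets of occurrences of `a` in distinct columns, of which
  -- there are at most `nk - 1`.
  have hchoose : (Nat.card H * k - 1).choose k ≤ Nat.card H * k - 1 := by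
    choose r hr' using fun B : (Finset.univ.powersetCard k : Finset (Finset {l : Λ // l ≠ oneL})) =>
      hset B (Finset.mem_powersetCard.1 B.2).2
    have hinj : Function.Injective r := by
      intro B C hBC
      refine Subtype.ext (Finset.ext fun l => ?_)
      rw [← hr' B, ← hr' C, hBC]
    have := Fintype.card_le_of_injective r hinj
    rw [Fintype.card_coe, Finset.card_powersetCard, Finset.card_univ, hcL] at this
    exact this.trans hcR
  rcases Nat.eq_one_or_of_choose_le hn hk hchoose with rfl | ⟨hn2, rfl⟩
  · have hn3 := card_subgroup_le_three hP hr (by simpa using hle) hmem ⟨j₀, hj₀⟩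
      (by rw [hcard, mul_one]) hcol
    obtain ⟨r, hx⟩ := exists_equiv_of_matching (P := P) (x := a) hle (fun l' => by
      obtain ⟨j, hj⟩ := hset {l'} (by simp)
      exact ⟨j, by simpa using hj⟩)
    have hIΛ := card_eq_of_matching r
    refine ⟨hIΛ, ?_⟩
    rw [hIΛ]
    rw [mul_one] at hcardΛ
    rw [hcardΛ]
    obtain h2 | h3 : Nat.card H = 2 ∨ Nat.card H = 3 := by omega
    · left
      refine ⟨h2, h2, Subgroup.nonempty_mulEquiv_zmod h2, a, Subgroup.coe_eq_pair h2 ha ha1, ?_⟩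
      refine exists_matching_form (m := 1) (y := a) (hcardΛ.trans h2) r hx ?_ ?_
      · intro l l' hne
        rw [h2] at hcL
        exact absurd (Fintype.card_le_one_iff.1 hcL.le l l') hne
      · intro s t
        fin_cases s
        fin_cases t
        simp
    · right; left
      have hH3 := Subgroup.coe_eq_triple h3 ha ha1
      refine ⟨h3, h3, Subgroup.nonempty_mulEquiv_zmod h3, a, hH3, ?_⟩
      refine exists_matching_form (m := 2) (y := a⁻¹) (hcardΛ.trans h3) r hx ?_ ?_
      · intro l l' hne
        -- Each value occurs once in this column: `1` in row `oneL` and `a` in row `l'`, so only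
        -- `a⁻¹` remains.
        have h : P l (r l') ∈ ({1, a, a⁻¹} : Set G) := hH3 ▸ hmem _ _
        rcases h with h | h | h
        · exact absurd (Finset.card_le_one.1 (hcol (r l') (r l').2 1 H.one_mem).le l
            (by simpa using h) oneL (by simp [hP.1])) l.2
        · exact absurd ((hx l l').1 h) hne
        · exact h
      · intro s t
        fin_cases s <;> fin_cases t <;> simp
  · have hpair := Subgroup.coe_eq_pair hn2 ha ha1
    have hvals : ∀ l i, P l i = 1 ∨ P l i = a := fun l i => by
      have h : P l i ∈ ({1, a} : Set G) := hpair ▸ hmem _ _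
      exact h
    rw [hn2] at hcL hcardΛ
    -- There are three non-trivial rows and `a` occupies two of them in each column, so the matching
    -- is read off from the remaining `1`.
    obtain ⟨r, hx⟩ := exists_equiv_of_matching (P := P) (x := (1 : G)) hle (fun l' => by
      obtain ⟨j, hj⟩ := hset (Finset.univ.erase l') (by
        rw [Finset.card_erase_of_mem (Finset.mem_univ _), Finset.card_univ, hcL])
      refine ⟨j, fun l => ?_⟩
      have := hj l
      simp only [Finset.mem_erase, Finset.mem_univ, and_true] at this
      rcases hvals l j with h | h
      · rw [h] at this ⊢
        exact iff_of_true rfl (by_contra fun h' => ha1 (this.2 h').symm)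
      · exact iff_of_false (by rw [h]; exact ha1) (this.1 h))
    have hIΛ := card_eq_of_matching r
    refine ⟨hIΛ, Or.inr (Or.inr ?_)⟩
    rw [hIΛ]
    refine ⟨hcardΛ, hcardΛ, Subgroup.nonempty_mulEquiv_zmod hn2, a, hpair, ?_⟩
    refine exists_matching_form (m := 3) (y := a) hcardΛ r hx (fun l l' hne =>
      (hvals l (r l')).resolve_left fun h => hne ((hx l l').1 h)) ?_
    intro s t
    fin_cases s <;> fin_cases t <;> simp

end Finite

/-! ### Sufficiency: homogeneity from extension and transitivity properties of the matrix. -/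

/-- Every finite partial map of the indices that is compatible with an automorphism of `G` on the
entries of `P` extends to permutations of the indices. -/
def EntryExtensible {G I Λ : Type*} [Group G] (P : Matrix Λ I G) (oneI : I) (oneL : Λ) : Prop :=
  ∀ (Θ : G ≃* G) (A : Set I) (B : Set Λ) (ψ₀ : I → I) (χ₀ : Λ → Λ), A.Finite → B.Finite →
    oneI ∈ A → oneL ∈ B → Set.InjOn ψ₀ A → Set.InjOn χ₀ B → ψ₀ oneI = oneI → χ₀ oneL = oneL →
    (∀ l ∈ B, ∀ i ∈ A, Θ (P l i) = P (χ₀ l) (ψ₀ i)) →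
    ∃ (ψ : Equiv.Perm I) (χ : Equiv.Perm Λ), (∀ i ∈ A, ψ i = ψ₀ i) ∧ (∀ l ∈ B, χ l = χ₀ l) ∧
      ∀ l i, Θ (P l i) = P (χ l) (ψ i)

/-- Up to multiplying rows and columns by group elements, the pairs of indices of `P` are
permuted transitively. -/
def EntryTransitive {G I Λ : Type*} [Group G] (P : Matrix Λ I G) (oneI : I) (oneL : Λ) : Prop :=
  ∀ (i₀ : I) (l₀ : Λ), ∃ (ψ : Equiv.Perm I) (χ : Equiv.Perm Λ) (u : I → G) (v : Λ → G),
    ψ oneI = i₀ ∧ χ oneL = l₀ ∧ ∀ l i, P l i = v l * P (χ l) (ψ i) * u i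

namespace ReesMatrixSemigroup

variable {G I Λ : Type*} [Group G] {P : Matrix Λ I G} {oneI : I} {oneL : Λ}

theorem idxI_mem (hP : IsNormalised P oneI oneL) {T : Subsemigroup (ReesMatrixSemigroup P)}
    (hT : ∀ x ∈ T, ∀ y, IsRelativeInverse x y → y ∈ T) (he : ⟨oneI, 1, oneL⟩ ∈ T)
    {x : ReesMatrixSemigroup P} (hx : x ∈ T) : ⟨x.idxI, 1, oneL⟩ ∈ T := by
  have hxe := mul_mem hx he
  refine (?_ : (⟨x.idxI, 1, oneL⟩ : ReesMatrixSemigroup P) =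
    (x * ⟨oneI, 1, oneL⟩) * ⟨x.idxI, x.val⁻¹, oneL⟩) ▸
      mul_mem hxe (hT _ hxe _ ((isRelativeInverse_iff _ _).2 ?_)) <;>
  ext <;> simp [hP.1, hP.2]

theorem idxL_mem (hP : IsNormalised P oneI oneL) {T : Subsemigroup (ReesMatrixSemigroup P)}
    (hT : ∀ x ∈ T, ∀ y, IsRelativeInverse x y → y ∈ T) (he : ⟨oneI, 1, oneL⟩ ∈ T)
    {x : ReesMatrixSemigroup P} (hx : x ∈ T) : ⟨oneI, 1, x.idxL⟩ ∈ T := by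
  have hex := mul_mem he hx
  refine (?_ : (⟨oneI, 1, x.idxL⟩ : ReesMatrixSemigroup P) =
    ⟨oneI, x.val⁻¹, x.idxL⟩ * (⟨oneI, 1, oneL⟩ * x)) ▸
      mul_mem (hT _ hex _ ((isRelativeInverse_iff _ _).2 ?_)) hex <;>
  ext <;> simp [hP.1, hP.2]

theorem val_mem (hP : IsNormalised P oneI oneL) {T : Subsemigroup (ReesMatrixSemigroup P)}
    (he : ⟨oneI, 1, oneL⟩ ∈ T) {x : ReesMatrixSemigroup P} (hx : x ∈ T) :
    ⟨oneI, x.val, oneL⟩ ∈ T := by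
  refine (?_ : (⟨oneI, x.val, oneL⟩ : ReesMatrixSemigroup P) =
    ⟨oneI, 1, oneL⟩ * x * ⟨oneI, 1, oneL⟩) ▸ mul_mem (mul_mem he hx) he
  ext <;> simp [hP.1, hP.2]

/-- The maximal subgroup at the normalising indices of a unary subsemigroup, as a subgroup of `G`. -/
def groupPart (hP : IsNormalised P oneI oneL) (T : Subsemigroup (ReesMatrixSemigroup P))
    (hT : ∀ x ∈ T, ∀ y, IsRelativeInverse x y → y ∈ T) (he : ⟨oneI, 1, oneL⟩ ∈ T) : Subgroup G where
  carrier := {g | (⟨oneI, g, oneL⟩ : ReesMatrixSemigroup P) ∈ T}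
  mul_mem' {g h} hg hh := by
    have : (⟨oneI, g * h, oneL⟩ : ReesMatrixSemigroup P) = ⟨oneI, g, oneL⟩ * ⟨oneI, h, oneL⟩ := by
      ext <;> simp [hP.1]
    show _ ∈ T
    rw [this]
    exact mul_mem hg hh
  one_mem' := he
  inv_mem' {g} hg := hT _ hg _ ((isRelativeInverse_iff _ _).2 (by ext <;> simp [hP.1]))

theorem entry_mem (hP : IsNormalised P oneI oneL) {T : Subsemigroup (ReesMatrixSemigroup P)}
    (hT : ∀ x ∈ T, ∀ y, IsRelativeInverse x y → y ∈ T) (he : ⟨oneI, 1, oneL⟩ ∈ T)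
    {x y : ReesMatrixSemigroup P} (hx : x ∈ T) (hy : y ∈ T) :
    ⟨oneI, P x.idxL y.idxI, oneL⟩ ∈ T := by
  refine (?_ : (⟨oneI, P x.idxL y.idxI, oneL⟩ : ReesMatrixSemigroup P) =
    ⟨oneI, 1, x.idxL⟩ * ⟨y.idxI, 1, oneL⟩) ▸ mul_mem (idxL_mem hP hT he hx) (idxI_mem hP hT he hy)
  ext <;> simp

/-- A finitely generated unary subsemigroup has finitely many indices and a finitely generated
maximal subgroup. -/
theorem finite_components (hP : IsNormalised P oneI oneL) (X : Finset (ReesMatrixSemigroup P))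
    (hT : ∀ x ∈ unaryClosure (X : Set (ReesMatrixSemigroup P)), ∀ y, IsRelativeInverse x y →
      y ∈ unaryClosure (X : Set (ReesMatrixSemigroup P)))
    (he : ⟨oneI, 1, oneL⟩ ∈ unaryClosure (X : Set (ReesMatrixSemigroup P))) :
    {i | ⟨i, 1, oneL⟩ ∈ unaryClosure (X : Set (ReesMatrixSemigroup P))}.Finite ∧
    {l | ⟨oneI, 1, l⟩ ∈ unaryClosure (X : Set (ReesMatrixSemigroup P))}.Finite ∧
    (groupPart hP (unaryClosure (X : Set (ReesMatrixSemigroup P))) hT he).FG := by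
  classical
  set A : Set I := idxI '' (X : Set (ReesMatrixSemigroup P))
  set B : Set Λ := idxL '' (X : Set (ReesMatrixSemigroup P))
  have hA : A.Finite := X.finite_toSet.image _
  have hB : B.Finite := X.finite_toSet.image _
  -- The values of the generators and the entries at their indices bound the group part from above;
  -- each of them also belongs to it.
  set F : Set G := val '' (X : Set (ReesMatrixSemigroup P)) ∪ Set.image2 P B A
  have hF : F.Finite := (X.finite_toSet.image _).union (hB.image2 _ hA)
  have hbox : ∀ l ∈ B, ∀ i ∈ A, P l i ∈ Subgroup.closure F := fun l hl i hi =>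
    Subgroup.subset_closure (Or.inr ⟨l, hl, i, hi, rfl⟩)
  have hle : unaryClosure (X : Set (ReesMatrixSemigroup P)) ≤ box A (Subgroup.closure F) B hbox :=
    unaryClosure_le
      (fun x hx => ⟨⟨x, hx, rfl⟩, Subgroup.subset_closure (Or.inl ⟨x, hx, rfl⟩), ⟨x, hx, rfl⟩⟩)
      fun x hx y h => box_inv_mem hx h
  refine ⟨hA.subset fun i hi => (hle hi).1, hB.subset fun l hl => (hle hl).2.2, hF.toFinset, ?_⟩
  rw [Set.Finite.coe_toFinset]
  refine le_antisymm ((Subgroup.closure_le _).2 ?_) fun g hg => (hle hg).2.1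
  rintro _ (⟨x, hx, rfl⟩ | ⟨_, ⟨x, hx, rfl⟩, _, ⟨y, hy, rfl⟩, rfl⟩)
  · exact val_mem hP he (subset_unaryClosure _ hx)
  · exact entry_mem hP hT he (subset_unaryClosure _ hx) (subset_unaryClosure _ hy)

/-- A partial homomorphism fixing the distinguished idempotent extends to an automorphism. -/
theorem exists_aut_extending_of_fixing (hP : IsNormalised P oneI oneL) (hG : IsHomogeneousGroup G)
    (hE : EntryExtensible P oneI oneL) (X : Finset (ReesMatrixSemigroup P))
    (he : ⟨oneI, 1, oneL⟩ ∈ unaryClosure (X : Set (ReesMatrixSemigroup P)))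
    (F : ReesMatrixSemigroup P → ReesMatrixSemigroup P)
    (hmul : ∀ x ∈ unaryClosure (X : Set (ReesMatrixSemigroup P)),
      ∀ y ∈ unaryClosure (X : Set (ReesMatrixSemigroup P)), F (x * y) = F x * F y)
    (hinj : Set.InjOn F (unaryClosure (X : Set (ReesMatrixSemigroup P))))
    (hFe : F ⟨oneI, 1, oneL⟩ = ⟨oneI, 1, oneL⟩) :
    ∃ Φ : ReesMatrixSemigroup P ≃* ReesMatrixSemigroup P,
      ∀ x ∈ unaryClosure (X : Set (ReesMatrixSemigroup P)), Φ x = F x := by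
  have hT : ∀ x ∈ unaryClosure (X : Set (ReesMatrixSemigroup P)), ∀ y, IsRelativeInverse x y →
      y ∈ unaryClosure (X : Set (ReesMatrixSemigroup P)) :=
    fun x hx y h => unaryClosure_inv_mem hx h
  obtain ⟨hA, hB, hFG⟩ := finite_components hP X hT he
  set T := unaryClosure (X : Set (ReesMatrixSemigroup P)) with hTdef
  -- The products of `(i, 1, 1)` with the distinguished idempotent on either side fix the row index
  -- and the group component of its image.
  have hFI : ∀ i, ⟨i, 1, oneL⟩ ∈ T → F ⟨i, 1, oneL⟩ = ⟨(F ⟨i, 1, oneL⟩).idxI, 1, oneL⟩ := by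
    intro i hi
    have h₁ := hmul _ hi _ he
    have h₂ := hmul _ he _ hi
    rw [show (⟨i, 1, oneL⟩ * ⟨oneI, 1, oneL⟩ : ReesMatrixSemigroup P) = ⟨i, 1, oneL⟩ by
      ext <;> simp [hP.1], hFe] at h₁
    rw [show (⟨oneI, 1, oneL⟩ * ⟨i, 1, oneL⟩ : ReesMatrixSemigroup P) = ⟨oneI, 1, oneL⟩ by
      ext <;> simp [hP.1], hFe] at h₂
    have h₃ := congrArg val h₂
    ext
    · rfl
    · simpa [hP.1] using h₃.symm
    · exact (congrArg idxL h₁ :)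
  have hFL : ∀ l, ⟨oneI, 1, l⟩ ∈ T → F ⟨oneI, 1, l⟩ = ⟨oneI, 1, (F ⟨oneI, 1, l⟩).idxL⟩ := by
    intro l hl
    have h₁ := hmul _ he _ hl
    have h₂ := hmul _ hl _ he
    rw [show (⟨oneI, 1, oneL⟩ * ⟨oneI, 1, l⟩ : ReesMatrixSemigroup P) = ⟨oneI, 1, l⟩ by
      ext <;> simp [hP.1], hFe] at h₁
    rw [show (⟨oneI, 1, l⟩ * ⟨oneI, 1, oneL⟩ : ReesMatrixSemigroup P) = ⟨oneI, 1, oneL⟩ by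
      ext <;> simp [hP.2], hFe] at h₂
    have h₃ := congrArg val h₂
    ext
    · exact (congrArg idxI h₁ :)
    · simpa [hP.2] using h₃.symm
    · rfl
  have hFg : ∀ g, ⟨oneI, g, oneL⟩ ∈ T →
      F ⟨oneI, g, oneL⟩ = ⟨oneI, (F ⟨oneI, g, oneL⟩).val, oneL⟩ := by
    intro g hg
    have h₁ := hmul _ he _ hg
    have h₂ := hmul _ hg _ he
    rw [show (⟨oneI, 1, oneL⟩ * ⟨oneI, g, oneL⟩ : ReesMatrixSemigroup P) = ⟨oneI, g, oneL⟩ by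
      ext <;> simp [hP.1], hFe] at h₁
    rw [show (⟨oneI, g, oneL⟩ * ⟨oneI, 1, oneL⟩ : ReesMatrixSemigroup P) = ⟨oneI, g, oneL⟩ by
      ext <;> simp [hP.1], hFe] at h₂
    ext
    · exact (congrArg idxI h₁ :)
    · rfl
    · exact (congrArg idxL h₂ :)
  let θ₀ : groupPart hP T hT he →* G := MonoidHom.mk' (fun g => (F ⟨oneI, g, oneL⟩).val) (by
    intro g h
    have := hmul _ g.2 _ h.2
    rw [show (⟨oneI, g, oneL⟩ * ⟨oneI, h, oneL⟩ : ReesMatrixSemigroup P) =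
      ⟨oneI, (g * h : groupPart hP T hT he), oneL⟩ by ext <;> simp [hP.1],
      hFg _ g.2, hFg _ h.2] at this
    rw [this]
    simp [hP.1])
  have hθ₀ : Function.Injective θ₀ := by
    intro g h hgh
    have : F ⟨oneI, g, oneL⟩ = F ⟨oneI, h, oneL⟩ := by
      rw [hFg _ g.2, hFg _ h.2]
      exact congrArg (fun x => (⟨oneI, x, oneL⟩ : ReesMatrixSemigroup P)) hgh
    exact Subtype.ext (congrArg val (hinj g.2 h.2 this))
  have hFG' : θ₀.range.FG := by
    rw [← Group.fg_iff_subgroup_fg] at hFG ⊢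
    exact Group.fg_of_surjective θ₀.rangeRestrict_surjective
  obtain ⟨Θ, hΘ⟩ := hG _ _ hFG hFG' (MonoidHom.ofInjective hθ₀)
  have hΘ' : ∀ g, ⟨oneI, g, oneL⟩ ∈ T → F ⟨oneI, g, oneL⟩ = ⟨oneI, Θ g, oneL⟩ := by
    intro g hg
    rw [hFg g hg]
    exact congrArg (fun x => (⟨oneI, x, oneL⟩ : ReesMatrixSemigroup P)) (hΘ ⟨g, hg⟩).symm
  obtain ⟨ψ, χ, hψ, hχ, hent⟩ := hE Θ
    {i | (⟨i, 1, oneL⟩ : ReesMatrixSemigroup P) ∈ T}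
    {l | (⟨oneI, 1, l⟩ : ReesMatrixSemigroup P) ∈ T}
    (fun i => (F ⟨i, 1, oneL⟩).idxI) (fun l => (F ⟨oneI, 1, l⟩).idxL) hA hB he he
    (by
      intro i hi j hj hij
      have : F ⟨i, 1, oneL⟩ = F ⟨j, 1, oneL⟩ := by
        rw [hFI i hi, hFI j hj]
        exact congrArg (fun x => (⟨x, 1, oneL⟩ : ReesMatrixSemigroup P)) hij
      exact congrArg idxI (hinj hi hj this))
    (by
      intro i hi j hj hij
      have : F ⟨oneI, 1, i⟩ = F ⟨oneI, 1, j⟩ := by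
        rw [hFL i hi, hFL j hj]
        exact congrArg (fun x => (⟨oneI, 1, x⟩ : ReesMatrixSemigroup P)) hij
      exact congrArg idxL (hinj hi hj this))
    (by simp [hFe]) (by simp [hFe])
    (by
      intro l hl i hi
      have h := hmul _ hl _ hi
      have he' : (⟨oneI, 1, l⟩ * ⟨i, 1, oneL⟩ : ReesMatrixSemigroup P) =
          ⟨oneI, P l i, oneL⟩ := by
        ext <;> simp
      rw [he', hΘ' (P l i) (he' ▸ mul_mem hl hi), hFL l hl, hFI i hi] at h
      simpa using congrArg val h)
  refine ⟨autOfData Θ ψ χ 1 1 (by simpa using hent), fun x hx => ?_⟩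
  have hxI := idxI_mem hP hT he hx
  have hxL := idxL_mem hP hT he hx
  have hxv := val_mem hP he hx
  have hdec : x = ⟨x.idxI, 1, oneL⟩ * ⟨oneI, x.val, oneL⟩ * ⟨oneI, 1, x.idxL⟩ := by
    ext <;> simp [hP.1]
  have hFx : F x = ⟨(F ⟨x.idxI, 1, oneL⟩).idxI, Θ x.val, (F ⟨oneI, 1, x.idxL⟩).idxL⟩ := by
    nth_rewrite 1 [hdec]
    rw [hmul _ (mul_mem hxI hxv) _ hxL, hmul _ hxI _ hxv, hΘ' _ hxv]
    rw [hFI _ hxI, hFL _ hxL]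
    ext <;> simp [hP.1]
  rw [hFx, ← hψ _ hxI, ← hχ _ hxL]
  ext <;> simp [autOfData]

/-- Automorphisms are transitive on idempotents, so composing with suitable ones before and after
reduces to a partial isomorphism that fixes the distinguished idempotent. -/
theorem isHomogeneousCompletelyRegular (hP : IsNormalised P oneI oneL)
    (hG : IsHomogeneousGroup G) (hE : EntryExtensible P oneI oneL)
    (ht : EntryTransitive P oneI oneL) :
    IsHomogeneousCompletelyRegular (ReesMatrixSemigroup P) := by
  classical
  have htrans : ∀ e : ReesMatrixSemigroup P, IsIdempotentElem e →
      ∃ α : ReesMatrixSemigroup P ≃* ReesMatrixSemigroup P, α ⟨oneI, 1, oneL⟩ = e := by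
    intro e he
    obtain ⟨ψ, χ, u, v, hψ, hχ, h⟩ := ht e.idxI e.idxL
    refine ⟨autOfData (MulEquiv.refl G) ψ χ u v h, ?_⟩
    have hid : IsIdempotentElem (autOfData (MulEquiv.refl G) ψ χ u v h ⟨oneI, 1, oneL⟩) :=
      IsIdempotentElem.map ((isIdempotentElem_iff _).2 (by simp [hP.1])) _
    have hI : (autOfData (MulEquiv.refl G) ψ χ u v h ⟨oneI, 1, oneL⟩).idxI = e.idxI := hψ
    have hL : (autOfData (MulEquiv.refl G) ψ χ u v h ⟨oneI, 1, oneL⟩).idxL = e.idxL := hχ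
    refine ReesMatrixSemigroup.ext hI ?_ hL
    rw [(isIdempotentElem_iff _).1 hid, (isIdempotentElem_iff _).1 he, hI, hL]
  intro X Y φ
  rcases X.eq_empty_or_nonempty with rfl | ⟨x, hx⟩
  · refine ⟨MulEquiv.refl _, fun t => ?_⟩
    have hbot :
        unaryClosure ((∅ : Finset (ReesMatrixSemigroup P)) : Set (ReesMatrixSemigroup P)) ≤ ⊥ :=
      unaryClosure_le (by simp) fun x hx => absurd hx Subsemigroup.notMem_bot
    exact absurd (hbot t.2) Subsemigroup.notMem_bot
  have hxT := subset_unaryClosure (X : Set (ReesMatrixSemigroup P)) hx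
  have hx' := (isRelativeInverse_iff x _).2 rfl
  set x' : ReesMatrixSemigroup P :=
    ⟨x.idxI, (P x.idxL x.idxI)⁻¹ * x.val⁻¹ * (P x.idxL x.idxI)⁻¹, x.idxL⟩
  have heT : x * x' ∈ unaryClosure (X : Set (ReesMatrixSemigroup P)) :=
    mul_mem hxT (unaryClosure_inv_mem hxT hx')
  have he : IsIdempotentElem (x * x') := by
    rw [IsIdempotentElem, ← mul_assoc, hx'.1]
  have hf : IsIdempotentElem (φ ⟨x * x', heT⟩ : ReesMatrixSemigroup P) := by
    have : IsIdempotentElem (⟨x * x', heT⟩ : unaryClosure (X : Set (ReesMatrixSemigroup P))) :=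
      Subtype.ext he
    exact congrArg Subtype.val (this.map φ)
  obtain ⟨α, hα⟩ := htrans _ he
  obtain ⟨β, hβ⟩ := htrans _ hf
  have hmem : ∀ t ∈ unaryClosure ((X.image α.symm : Finset _) : Set (ReesMatrixSemigroup P)),
      α t ∈ unaryClosure (X : Set (ReesMatrixSemigroup P)) := by
    intro t ht
    have := map_mem_unaryClosure_image α ht
    rwa [Finset.coe_image, ← Set.image_comp, show (α ∘ α.symm : _ → _) = id from
      funext α.apply_symm_apply, Set.image_id] at this
  have hmem' : ∀ t ∈ unaryClosure (X : Set (ReesMatrixSemigroup P)),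
      α.symm t ∈ unaryClosure ((X.image α.symm : Finset _) : Set (ReesMatrixSemigroup P)) := by
    intro t ht
    rw [Finset.coe_image]
    exact map_mem_unaryClosure_image α.symm ht
  -- The value `t` outside the domain is arbitrary and plays no role.
  let F : ReesMatrixSemigroup P → ReesMatrixSemigroup P := fun t =>
    if h : α t ∈ unaryClosure (X : Set (ReesMatrixSemigroup P)) then β.symm (φ ⟨α t, h⟩) else t
  have hF : ∀ t (h : α t ∈ unaryClosure (X : Set (ReesMatrixSemigroup P))),
      F t = β.symm (φ ⟨α t, h⟩) := fun t h => dif_pos h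
  obtain ⟨Φ, hΦ⟩ := exists_aut_extending_of_fixing hP hG hE (X.image α.symm)
    (by
      have := hmem' _ heT
      rwa [← hα, α.symm_apply_apply] at this)
    F
    (by
      intro s hs t ht
      have h : φ ⟨α (s * t), hmem _ (mul_mem hs ht)⟩ =
          φ ⟨α s, hmem _ hs⟩ * φ ⟨α t, hmem _ ht⟩ := by
        rw [← map_mul]
        exact congrArg φ (Subtype.ext (map_mul α s t))
      rw [hF _ (hmem _ (mul_mem hs ht)), hF _ (hmem _ hs), hF _ (hmem _ ht), h]
      exact map_mul β.symm _ _)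
    (by
      intro s hs t ht hst
      rw [hF _ (hmem _ hs), hF _ (hmem _ ht)] at hst
      exact α.injective (congrArg Subtype.val
        (φ.injective (Subtype.ext (β.symm.injective hst)))))
    (by
      rw [hF _ (hα ▸ heT), MulEquiv.symm_apply_eq, hβ]
      congr 2
      exact Subtype.ext hα)
  refine ⟨(α.symm.trans Φ).trans β, fun t => ?_⟩
  show β (Φ (α.symm t)) = _
  rw [hΦ _ (hmem' t t.2), hF _ (by rw [α.apply_symm_apply]; exact t.2), β.apply_symm_apply]
  congr 2
  exact Subtype.ext (α.apply_symm_apply _)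

end ReesMatrixSemigroup

theorem Set.InjOn.exists_perm {α : Type*} {f : α → α} {A : Set α} (hf : Set.InjOn f A)
    (hA : A.Finite) : ∃ σ : Equiv.Perm α, ∀ a ∈ A, σ a = f a := by
  have := hA.to_subtype
  obtain ⟨σ, hσ⟩ := Equiv.Perm.exists_extending_pair (fun a : A => (a : α)) (fun a : A => f a)
    Subtype.val_injective (Set.injOn_iff_injective.1 hf)
  exact ⟨σ, fun a ha => hσ ⟨a, ha⟩⟩

/-! ### Extension and transitivity for matching matrices and tables. -/

section Extensible

variable {G I Λ : Type*} [Group G] {P : Matrix Λ I G} {oneI : I} {oneL : Λ}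

theorem entryExtensible_of_eq_one (h : ∀ l i, P l i = 1) : EntryExtensible P oneI oneL := by
  intro Θ A B ψ₀ χ₀ hA hB _ _ hψ hχ _ _ _
  obtain ⟨ψ, hψ'⟩ := hψ.exists_perm hA
  obtain ⟨χ, hχ'⟩ := hχ.exists_perm hB
  exact ⟨ψ, χ, hψ', hχ', fun l i => by rw [h, h, map_one]⟩

theorem entryTransitive_of_eq_one (h : ∀ l i, P l i = 1) : EntryTransitive P oneI oneL := by
  classical
  intro i₀ l₀
  exact ⟨Equiv.swap oneI i₀, Equiv.swap oneL l₀, 1, 1, Equiv.swap_apply_left _ _,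
    Equiv.swap_apply_left _ _, fun l i => by simp [h]⟩

/-- The matrix `P'` has the entry `x` along the matching `σ` of rows and columns and the entry `y`
elsewhere. -/
structure IsMatching (P : Matrix Λ I G) (oneI : I) (oneL : Λ) (σ : Λ ≃ I) (x y : G) : Prop where
  ne : x ≠ y
  map_one : σ oneL = oneI
  apply_self : ∀ l, l ≠ oneL → P l (σ l) = x
  apply_ne : ∀ l l', l ≠ oneL → l' ≠ oneL → l ≠ l' → P l (σ l') = y

/-- Finite partial maps preserving the entries of `P` extend if `P'` is given by a matching. -/
theorem IsMatching.exists_perm (hP : IsNormalised P oneI oneL) {σ : Λ ≃ I} {x y : G}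
    (hσ : IsMatching P oneI oneL σ x y) {A : Set I} {B : Set Λ} {ψ₀ : I → I} {χ₀ : Λ → Λ}
    (hA : A.Finite) (hB : B.Finite) (h1A : oneI ∈ A) (h1B : oneL ∈ B) (hψ : Set.InjOn ψ₀ A)
    (hχ : Set.InjOn χ₀ B) (hψ1 : ψ₀ oneI = oneI) (hχ1 : χ₀ oneL = oneL)
    (h : ∀ l ∈ B, ∀ i ∈ A, P l i = P (χ₀ l) (ψ₀ i)) :
    ∃ (ψ : Equiv.Perm I) (χ : Equiv.Perm Λ), (∀ i ∈ A, ψ i = ψ₀ i) ∧ (∀ l ∈ B, χ l = χ₀ l) ∧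
      ∀ l i, P l i = P (χ l) (ψ i) := by
  classical
  have hσ' : ∀ l, σ l = oneI ↔ l = oneL := fun l => by
    rw [← hσ.map_one, σ.injective.eq_iff]
  have hiff : ∀ l l', l ≠ oneL → l' ≠ oneL → (P l (σ l') = x ↔ l = l') := by
    intro l l' hl hl'
    constructor
    · intro hx
      by_contra hne
      exact hσ.ne (hx.symm.trans (hσ.apply_ne l l' hl hl' hne))
    · rintro rfl
      exact hσ.apply_self l hl
  -- The matched pairs are those non-trivial pairs with entry `x`, so preserving entries means
  -- preserving the matching.
  have key : ∀ l ∈ B, ∀ m, σ m ∈ A → (l = m ↔ χ₀ l = σ.symm (ψ₀ (σ m))) := by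
    intro l hl m hm
    have hl1 : χ₀ l = oneL ↔ l = oneL := by
      exact ⟨fun h' => hχ hl h1B (by rw [h', hχ1]), fun h' => by rw [h', hχ1]⟩
    have hm1 : σ.symm (ψ₀ (σ m)) = oneL ↔ m = oneL := by
      rw [Equiv.symm_apply_eq, hσ.map_one, ← hσ']
      exact ⟨fun h' => hψ hm h1A (by rw [h', hψ1]), fun h' => by rw [h', hψ1]⟩
    by_cases hlo : l = oneL
    · rw [hlo, hχ1, eq_comm, ← hm1, eq_comm]
    · by_cases hmo : m = oneL
      · rw [hmo, hσ.map_one, hψ1, (Equiv.symm_apply_eq σ).2 hσ.map_one.symm]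
        exact hl1.symm
      · rw [← hiff l m hlo hmo, ← hiff _ _ (mt hl1.1 hlo) (mt hm1.1 hmo), h l hl _ hm,
          Equiv.apply_symm_apply]
  -- Through the matching, the map on columns becomes a second partial map on rows; `key` makes the
  -- two agree on overlaps and jointly injective.
  let ω : Λ → Λ := fun l => if l ∈ B then χ₀ l else σ.symm (ψ₀ (σ l))
  have hωB : ∀ l ∈ B, ω l = χ₀ l := fun l hl => if_pos hl
  have hωA : ∀ l, σ l ∈ A → ω l = σ.symm (ψ₀ (σ l)) := by
    intro l hl
    by_cases hlB : l ∈ B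
    · rw [hωB l hlB]
      exact (key l hlB l hl).1 rfl
    · exact if_neg hlB
  have hωinj : Set.InjOn ω (B ∪ σ ⁻¹' A) := by
    rintro l (hl | hl) m (hm | hm) hlm
    · rw [hωB l hl, hωB m hm] at hlm
      exact hχ hl hm hlm
    · rw [hωB l hl, hωA m hm] at hlm
      exact (key l hl m hm).2 hlm
    · rw [hωA l hl, hωB m hm] at hlm
      exact ((key m hm l hl).2 hlm.symm).symm
    · rw [hωA l hl, hωA m hm] at hlm
      exact σ.injective (hψ hl hm (σ.symm.injective hlm))
  obtain ⟨χ, hχω⟩ := hωinj.exists_perm (hB.union (hA.preimage σ.injective.injOn))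
  have hχ1' : χ oneL = oneL := by rw [hχω _ (Or.inl h1B), hωB _ h1B, hχ1]
  have hχne : ∀ l, l ≠ oneL → χ l ≠ oneL := fun l hl h' =>
    hl (χ.injective (h'.trans hχ1'.symm))
  refine ⟨(σ.symm.trans χ).trans σ, χ, fun i hi => ?_, fun l hl => ?_, fun l i => ?_⟩
  · have hi' : σ (σ.symm i) ∈ A := by rwa [σ.apply_symm_apply]
    rw [Equiv.trans_apply, Equiv.trans_apply, hχω _ (Or.inr hi'), hωA _ hi',
      σ.apply_symm_apply, σ.apply_symm_apply]
  · rw [hχω l (Or.inl hl), hωB l hl]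
  · obtain ⟨m, rfl⟩ := σ.surjective i
    rw [Equiv.trans_apply, Equiv.trans_apply, σ.symm_apply_apply]
    by_cases hl : l = oneL
    · rw [hl, hχ1', hP.1, hP.1]
    · by_cases hm : m = oneL
      · rw [hm, hχ1', hσ.map_one, hP.2, hP.2]
      · by_cases hlm : l = m
        · rw [hlm, hσ.apply_self m hm, hσ.apply_self _ (hχne m hm)]
        · rw [hσ.apply_ne l m hl hm hlm,
            hσ.apply_ne _ _ (hχne l hl) (hχne m hm) (χ.injective.ne hlm)]

/-- The automorphism acts on the entries as a row permutation `τ`; precomposing the row map with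
`τ⁻¹` reduces to maps preserving entries. -/
theorem IsMatching.entryExtensible (hP : IsNormalised P oneI oneL) {σ : Λ ≃ I} {x y : G}
    (hσ : IsMatching P oneI oneL σ x y)
    (hΘ : ∀ Θ : G ≃* G, ∃ τ : Equiv.Perm Λ, τ oneL = oneL ∧ ∀ l i, Θ (P l i) = P (τ l) i) :
    EntryExtensible P oneI oneL := by
  intro Θ A B ψ₀ χ₀ hA hB h1A h1B hψ hχ hψ1 hχ1 h
  obtain ⟨τ, hτ1, hτ⟩ := hΘ Θ
  obtain ⟨ψ, χ, hψ', hχ', h'⟩ := hσ.exists_perm hP (A := A) (B := τ '' B) (ψ₀ := ψ₀)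
    (χ₀ := fun l => χ₀ (τ.symm l)) hA (hB.image _) h1A ⟨oneL, h1B, hτ1⟩ hψ
    (by
      rintro _ ⟨l, hl, rfl⟩ _ ⟨m, hm, rfl⟩ hlm
      simp only [Equiv.symm_apply_apply] at hlm
      rw [hχ hl hm hlm])
    hψ1 (by
      show χ₀ (τ.symm oneL) = oneL
      rw [(Equiv.symm_apply_eq τ).2 hτ1.symm, hχ1])
    (by
      rintro _ ⟨l, hl, rfl⟩ i hi
      show P (τ l) i = P (χ₀ (τ.symm (τ l))) (ψ₀ i)
      rw [Equiv.symm_apply_apply, ← hτ, h l hl i hi])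
  refine ⟨ψ, τ.trans χ, hψ', fun l hl => ?_, fun l i => ?_⟩
  · rw [Equiv.trans_apply, hχ' _ ⟨l, hl, rfl⟩, Equiv.symm_apply_apply]
  · rw [hτ, h']
    rfl

/-- `P` is entry transitive if its entries are images of a table over `ZMod q` that is, up to
normalisation, invariant under a transitive family of permutations. -/
theorem entryTransitive_of_table {m q : ℕ} [NeZero m] (E : Fin m ≃ Λ) (F : Fin m ≃ I)
    (hE : E 0 = oneL) (hF : F 0 = oneI) (w : ZMod q → G) (hw : ∀ x y, w (x + y) = w x * w y)
    (t : Fin m → Fin m → ZMod q) (hPt : ∀ r s, P (E r) (F s) = w (t r s))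
    (c : Fin m → Equiv.Perm (Fin m)) (hc : ∀ r, c r 0 = r)
    (ht : ∀ r₀ s₀ r s, t r s =
      (t r₀ s₀ - t (c r₀ r) s₀) + t (c r₀ r) (c s₀ s) + -t r₀ (c s₀ s)) :
    EntryTransitive P oneI oneL := by
  intro i₀ l₀
  obtain ⟨s₀, rfl⟩ := F.surjective i₀
  obtain ⟨r₀, rfl⟩ := E.surjective l₀
  refine ⟨(F.symm.trans (c s₀)).trans F, (E.symm.trans (c r₀)).trans E,
    fun i => w (-t r₀ (c s₀ (F.symm i))), fun l => w (t r₀ s₀ - t (c r₀ (E.symm l)) s₀), ?_, ?_,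
    fun l i => ?_⟩
  · simp [← hF, hc]
  · simp [← hE, hc]
  · obtain ⟨s, rfl⟩ := F.surjective i
    obtain ⟨r, rfl⟩ := E.surjective l
    simp only [Equiv.trans_apply, Equiv.symm_apply_apply]
    rw [hPt, hPt, ← hw, ← hw, ← ht]

end Extensible

theorem pow_zmod_val_add {G : Type*} [Group G] {q : ℕ} [NeZero q] {a : G} (ha : a ^ q = 1)
    (x y : ZMod q) : a ^ (x + y).val = a ^ x.val * a ^ y.val := by
  rw [ZMod.val_add, ← pow_add, ← pow_eq_pow_mod _ ha]

/-- Enumerations of the rows and columns of `P` induced by those of the reduced matrix. -/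
theorem HasForm.exists_equiv {G I Λ : Type*} [Group G] {P : Matrix Λ I G} {oneI : I} {oneL : Λ}
    (hP : IsNormalised P oneI oneL) {n : ℕ} {M : Matrix (Fin n) (Fin n) G}
    (h : HasForm (reducedMatrix P oneI oneL) M) :
    ∃ (E : Fin (n + 1) ≃ Λ) (F : Fin (n + 1) ≃ I), E 0 = oneL ∧ F 0 = oneI ∧
      ∀ r s, P (E r) (F s) = Fin.cases 1 (fun r' => Fin.cases 1 (fun s' => M r' s') s) r := by
  classical
  obtain ⟨e, f, h⟩ := h
  refine ⟨(finSuccEquiv n).trans ((Equiv.optionCongr e).trans (Equiv.optionSubtypeNe oneL)),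
    (finSuccEquiv n).trans ((Equiv.optionCongr f).trans (Equiv.optionSubtypeNe oneI)),
    by simp, by simp, fun r s => ?_⟩
  induction r using Fin.cases with
  | zero => simp [hP.1]
  | succ r =>
    induction s using Fin.cases with
    | zero => simp [hP.2]
    | succ s =>
      have h' : P (e r) (f s) = M r s := congrFun (congrFun h r) s
      simpa using h'

/-! ### The three non-trivial matrices. -/

section Cases

variable {G I Λ : Type*} [Group G] {P : Matrix Λ I G} {oneI : I} {oneL : Λ}

theorem Subgroup.pow_eq_one_of_mulEquiv {H : Subgroup G} {q : ℕ} [NeZero q]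
    (h : Nonempty (H ≃* Multiplicative (ZMod q))) {a : G} (ha : a ∈ H) : a ^ q = 1 := by
  have hc : Nat.card H = q := by
    rw [Nat.card_congr h.some.toEquiv]
    simp
  have := pow_card_eq_one' (x := (⟨a, ha⟩ : H))
  rw [hc] at this
  exact congrArg Subtype.val this

theorem Subgroup.ncard_of_mulEquiv {H : Subgroup G} {q : ℕ} [NeZero q]
    (h : Nonempty (H ≃* Multiplicative (ZMod q))) : (H : Set G).ncard = q := by
  show Nat.card H = q
  rw [Nat.card_congr h.some.toEquiv]
  simp

theorem Subgroup.Characteristic.map_mem {H : Subgroup G} (hH : H.Characteristic) (Θ : G ≃* G)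
    {x : G} (hx : x ∈ H) : Θ x ∈ H :=
  Subgroup.characteristic_iff_map_le.1 hH Θ ⟨x, hx, rfl⟩

/-- An automorphism preserves `H` and fixes `1`, so it has to fix the only other element. -/
theorem map_eq_of_coe_eq_pair {H : Subgroup G} (hH : H.Characteristic) {a : G}
    (ha : (H : Set G) = {1, a}) (Θ : G ≃* G) {x : G} (hx : x ∈ H) : Θ x = x := by
  have hmem : ∀ y ∈ H, y = 1 ∨ y = a := fun y hy => by
    have : y ∈ ({1, a} : Set G) := ha ▸ hy
    exact this
  rcases hmem x hx with rfl | rfl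
  · exact map_one Θ
  · rcases hmem _ (hH.map_mem Θ hx) with h | h
    · rw [h, (map_eq_one_iff Θ Θ.injective).1 h]
    · exact h

theorem entry_extensible_and_transitive_two (hP : IsNormalised P oneI oneL) {H : Subgroup G}
    (hH : (H : Set G) = matrixEntries P) (hchar : H.Characteristic)
    (hZ : Nonempty (H ≃* Multiplicative (ZMod 2))) {a : G} (ha : (H : Set G) = {1, a})
    (hM : HasForm (reducedMatrix P oneI oneL) !![a]) :
    EntryExtensible P oneI oneL ∧ EntryTransitive P oneI oneL := by
  have haH : a ∈ H := by
    rw [← SetLike.mem_coe, ha]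
    simp
  have ha2 := Subgroup.pow_eq_one_of_mulEquiv hZ haH
  have ha1 : a ≠ 1 := by
    rintro rfl
    have := Subgroup.ncard_of_mulEquiv hZ
    simp [ha] at this
  obtain ⟨E, F, hE, hF, hPEF⟩ := hM.exists_equiv hP
  have htab : ∀ r s, P (E r) (F s) = a ^ (if r = 0 ∨ s = 0 then 0 else 1 : ZMod 2).val := by
    intro r s
    rw [hPEF]
    fin_cases r <;> fin_cases s <;> simp [Fin.cases, Fin.induction, Fin.induction.go, ZMod.val_one]
  constructor
  -- There is one non-trivial row, so the off-matching value is vacuous; `1` only has to differ from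
  -- `a`.
  · have hσ : IsMatching P oneI oneL (E.symm.trans F) a 1 := by
      refine ⟨ha1, by simp [← hE, hF], ?_, ?_⟩
      · intro l hl
        obtain ⟨r, rfl⟩ := E.surjective l
        rw [← hE, Ne, E.injective.eq_iff] at hl
        rw [Equiv.trans_apply, Equiv.symm_apply_apply, htab]
        simp [hl, ZMod.val_one]
      · intro l l' hl hl' hne
        obtain ⟨r, rfl⟩ := E.surjective l
        obtain ⟨s, rfl⟩ := E.surjective l'
        rw [← hE, Ne, E.injective.eq_iff] at hl hl'
        rw [Ne, E.injective.eq_iff] at hne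
        omega
    refine hσ.entryExtensible hP fun Θ => ⟨1, rfl, fun l i => ?_⟩
    exact map_eq_of_coe_eq_pair hchar ha Θ (by rw [← SetLike.mem_coe, hH]; exact ⟨l, i, rfl⟩)
  · exact entryTransitive_of_table E F hE hF (fun x : ZMod 2 => a ^ x.val) (pow_zmod_val_add ha2)
      (fun r s => if r = 0 ∨ s = 0 then 0 else 1) htab (fun r => Equiv.addRight r) (by decide)
      (by decide)

/-- Translation by `r` in the elementary abelian group of order four, on `Fin 4`. -/
def xorPerm (r : Fin 4) : Equiv.Perm (Fin 4) where
  toFun s := s ^^^ r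
  invFun s := s ^^^ r
  left_inv := by revert r; unfold Function.LeftInverse; decide
  right_inv := by revert r; unfold Function.RightInverse Function.LeftInverse; decide

theorem entry_extensible_and_transitive_four (hP : IsNormalised P oneI oneL) {H : Subgroup G}
    (hH : (H : Set G) = matrixEntries P) (hchar : H.Characteristic)
    (hZ : Nonempty (H ≃* Multiplicative (ZMod 2))) {a : G} (ha : (H : Set G) = {1, a})
    (hM : HasForm (reducedMatrix P oneI oneL) !![1, a, a; a, 1, a; a, a, 1]) :
    EntryExtensible P oneI oneL ∧ EntryTransitive P oneI oneL := by
  have haH : a ∈ H := by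
    rw [← SetLike.mem_coe, ha]
    simp
  have ha2 := Subgroup.pow_eq_one_of_mulEquiv hZ haH
  have ha1 : a ≠ 1 := by
    rintro rfl
    have := Subgroup.ncard_of_mulEquiv hZ
    simp [ha] at this
  obtain ⟨E, F, hE, hF, hPEF⟩ := hM.exists_equiv hP
  have htab : ∀ r s, P (E r) (F s) =
      a ^ (if r = 0 ∨ s = 0 ∨ r = s then 0 else 1 : ZMod 2).val := by
    intro r s
    rw [hPEF]
    fin_cases r <;> fin_cases s <;> simp [Fin.cases, Fin.induction, Fin.induction.go, ZMod.val_one]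
  constructor
  · have hσ : IsMatching P oneI oneL (E.symm.trans F) 1 a := by
      refine ⟨ha1.symm, by simp [← hE, hF], ?_, ?_⟩
      · intro l hl
        obtain ⟨r, rfl⟩ := E.surjective l
        rw [Equiv.trans_apply, Equiv.symm_apply_apply, htab]
        simp
      · intro l l' hl hl' hne
        obtain ⟨r, rfl⟩ := E.surjective l
        obtain ⟨s, rfl⟩ := E.surjective l'
        rw [← hE, Ne, E.injective.eq_iff] at hl hl'
        rw [Ne, E.injective.eq_iff] at hne
        rw [Equiv.trans_apply, Equiv.symm_apply_apply, htab]
        simp [hl, hl', hne, ZMod.val_one]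
    refine hσ.entryExtensible hP fun Θ => ⟨1, rfl, fun l i => ?_⟩
    exact map_eq_of_coe_eq_pair hchar ha Θ (by rw [← SetLike.mem_coe, hH]; exact ⟨l, i, rfl⟩)
  -- The table is the alternating form on `(ℤ/2)²`, which vanishes exactly on dependent pairs;
  -- `xorPerm` supplies the translations.
  · exact entryTransitive_of_table E F hE hF (fun x : ZMod 2 => a ^ x.val) (pow_zmod_val_add ha2)
      (fun r s => if r = 0 ∨ s = 0 ∨ r = s then 0 else 1) htab xorPerm
      (by decide) (by decide)

theorem entry_extensible_and_transitive_three (hP : IsNormalised P oneI oneL) {H : Subgroup G}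
    (hchar : H.Characteristic)
    (hZ : Nonempty (H ≃* Multiplicative (ZMod 3))) {a : G} (ha : (H : Set G) = {1, a, a⁻¹})
    (hM : HasForm (reducedMatrix P oneI oneL) !![a, a⁻¹; a⁻¹, a]) :
    EntryExtensible P oneI oneL ∧ EntryTransitive P oneI oneL := by
  have haH : a ∈ H := by
    rw [← SetLike.mem_coe, ha]
    simp
  have ha3 := Subgroup.pow_eq_one_of_mulEquiv hZ haH
  have hncard := Subgroup.ncard_of_mulEquiv hZ
  have hinv : a ^ 2 = a⁻¹ := by
    rw [eq_inv_iff_mul_eq_one, ← pow_succ, ha3]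
  have hne : a ≠ a⁻¹ := by
    intro h
    have := Set.ncard_insert_le (1 : G) {a}
    rw [Set.ncard_singleton] at this
    rw [ha, ← h, Set.pair_eq_singleton] at hncard
    omega
  obtain ⟨E, F, hE, hF, hPEF⟩ := hM.exists_equiv hP
  -- The full matrix is `a ^ (r * s)`, the multiplication table of `ℤ/3` in the exponent.
  have htab : ∀ r s : Fin 3, P (E r) (F s) = a ^ ((r.val * s.val : ℕ) : ZMod 3).val := by
    intro r s
    rw [hPEF, ZMod.val_natCast]
    fin_cases r <;> fin_cases s <;>
      simp [Fin.cases, Fin.induction, Fin.induction.go, hinv]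
  constructor
  · have hσ : IsMatching P oneI oneL (E.symm.trans F) a a⁻¹ := by
      refine ⟨hne, by simp [← hE, hF], ?_, ?_⟩
      · intro l hl
        obtain ⟨r, rfl⟩ := E.surjective l
        rw [← hE, Ne, E.injective.eq_iff] at hl
        rw [Equiv.trans_apply, Equiv.symm_apply_apply, htab]
        rw [show ∀ r : Fin 3, r ≠ 0 → ((r.val * r.val : ℕ) : ZMod 3).val = 1 by decide, pow_one]
        exact hl
      · intro l l' hl hl' hne
        obtain ⟨r, rfl⟩ := E.surjective l
        obtain ⟨s, rfl⟩ := E.surjective l'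
        rw [← hE, Ne, E.injective.eq_iff] at hl hl'
        rw [Ne, E.injective.eq_iff] at hne
        rw [Equiv.trans_apply, Equiv.symm_apply_apply, htab, ← hinv]
        rw [show ∀ r s : Fin 3, r ≠ 0 → s ≠ 0 → r ≠ s → ((r.val * s.val : ℕ) : ZMod 3).val = 2 by decide]
        exacts [hl, hl', hne]
    refine hσ.entryExtensible hP fun Θ => ?_
    have hmem : Θ a ∈ ({1, a, a⁻¹} : Set G) := ha ▸ hchar.map_mem Θ haH
    have hΘ : ∀ r s : Fin 3, Θ (P (E r) (F s)) = Θ a ^ ((r.val * s.val : ℕ) : ZMod 3).val := fun r s => by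
      rw [htab, map_pow]
    rcases hmem with h | h | h
    · rw [map_eq_one_iff Θ Θ.injective] at h
      exact absurd (by rw [h, inv_one]) hne
    · refine ⟨1, rfl, fun l i => ?_⟩
      obtain ⟨r, rfl⟩ := E.surjective l
      obtain ⟨s, rfl⟩ := F.surjective i
      rw [hΘ, h, ← htab]
      rfl
    -- If `Θ` inverts `a`, negating the row index has the same effect, as `(-r) * s = -(r * s)`
    -- modulo 3.
    · refine ⟨(E.symm.trans (Equiv.neg (Fin 3))).trans E, by simp [← hE], fun l i => ?_⟩
      obtain ⟨r, rfl⟩ := E.surjective l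
      obtain ⟨s, rfl⟩ := F.surjective i
      rw [hΘ, h, Equiv.trans_apply, Equiv.trans_apply, Equiv.symm_apply_apply, htab, ← hinv,
        ← pow_mul, ← Nat.mod_add_div (2 * _) 3, pow_add, pow_mul a 3, ha3, one_pow, mul_one]
      congr 1
      revert r s
      decide
  · exact entryTransitive_of_table E F hE hF (fun x : ZMod 3 => a ^ x.val) (pow_zmod_val_add ha3)
      (fun r s => ((r.val * s.val : ℕ) : ZMod 3)) htab (fun r => Equiv.addRight r) (by decide) (by decide)

end Cases

/-! ### Assembly of the equivalence. -/

theorem matrixEntries_eq_one_iff {G I Λ : Type*} [Group G] {P : Matrix Λ I G} {oneI : I}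
    {oneL : Λ} (hP : IsNormalised P oneI oneL) : matrixEntries P = {1} ↔ ∀ l i, P l i = 1 := by
  constructor
  · intro h l i
    have : P l i ∈ ({1} : Set G) := h ▸ ⟨l, i, rfl⟩
    exact this
  · intro h
    refine Set.Subset.antisymm ?_ ?_
    · rintro _ ⟨l, i, rfl⟩
      exact h l i
    · rintro _ rfl
      exact one_mem_matrixEntries hP

theorem finite_matrixEntries {G I Λ : Type*} [Group G] {P : Matrix Λ I G} {oneI : I}
    {oneL : Λ} (hP : IsNormalised P oneI oneL)
    (hfin : (inducedGraph P oneI oneL).IsFinitelyColoured) : (matrixEntries P).Finite := by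
  have h : (matrixEntries (reducedMatrix P oneI oneL)).Finite := hfin
  refine (h.insert 1).subset ?_
  rintro _ ⟨l, i, rfl⟩
  by_cases hl : l = oneL
  · exact Or.inl (by rw [hl, hP.1])
  · by_cases hi : i = oneI
    · exact Or.inl (by rw [hi, hP.2])
    · exact Or.inr ⟨⟨l, hl⟩, ⟨i, hi⟩, rfl⟩

theorem lemma5p11 {G I Λ : Type*} [Group G] [Countable G] [Countable I] [Countable Λ]
    (P : Matrix Λ I G) (oneI : I) (oneL : Λ) (hP : IsNormalised P oneI oneL)
    (hfin : (inducedGraph P oneI oneL).IsFinitelyColoured)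
    (hgen : ¬ (inducedGraph P oneI oneL).IsOfGenericType) :
    (IsHomogeneousCompletelyRegular (ReesMatrixSemigroup P) ↔
      IsHomogeneousGroup G ∧
      ∃ H : Subgroup G, (H : Set G) = matrixEntries P ∧ H.Characteristic ∧
        ((H : Set G) = {1} ∨
         (Nat.card I = 2 ∧ Nat.card Λ = 2 ∧ Nonempty (H ≃* Multiplicative (ZMod 2)) ∧
            ∃ a : G, (H : Set G) = {1, a} ∧
              HasForm (reducedMatrix P oneI oneL) !![a]) ∨
         (Nat.card I = 3 ∧ Nat.card Λ = 3 ∧ Nonempty (H ≃* Multiplicative (ZMod 3)) ∧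
            ∃ a : G, (H : Set G) = {1, a, a⁻¹} ∧
              HasForm (reducedMatrix P oneI oneL) !![a, a⁻¹; a⁻¹, a]) ∨
         (Nat.card I = 4 ∧ Nat.card Λ = 4 ∧ Nonempty (H ≃* Multiplicative (ZMod 2)) ∧
            ∃ a : G, (H : Set G) = {1, a} ∧
              HasForm (reducedMatrix P oneI oneL) !![1, a, a; a, 1, a; a, a, 1]))) ∧
    (matrixEntries P = {1} → IsOrthodox (ReesMatrixSemigroup P)) := by
  have hfin' := finite_matrixEntries hP hfin
  refine ⟨⟨fun hom => ?_, ?_⟩, fun h =>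
    ReesMatrixSemigroup.isOrthodox ((matrixEntries_eq_one_iff hP).1 h)⟩
  · refine ⟨ReesMatrixSemigroup.isHomogeneousGroup hP hom, ?_⟩
    have hr := ReesMatrixSemigroup.rowExtensible hP hom hfin'
    have hc := ReesMatrixSemigroup.rowExtensible_invTranspose hP hom hfin'
    have hr' : RowExtensible (invTranspose (invTranspose P)) oneI oneL := by
      rwa [invTranspose_invTranspose]
    obtain ⟨H, hH⟩ := exists_subgroup_eq_matrixEntries hP hr hc
    refine ⟨H, hH, ?_, ?_⟩
    · rw [Subgroup.characteristic_iff_map_le]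
      rintro Θ _ ⟨x, hx, rfl⟩
      rw [hH] at hx
      obtain ⟨l, i, rfl⟩ := hx
      obtain ⟨ψ, χ, h⟩ := ReesMatrixSemigroup.exists_perm_of_mulEquiv hP hom hfin' Θ
      rw [← SetLike.mem_coe, hH]
      exact ⟨χ l, ψ i, (h l i).symm⟩
    · by_cases htriv : ∃ a ∈ H, a ≠ 1
      · right
        obtain ⟨a, ha, ha1⟩ := htriv
        have ha' : a ∈ matrixEntries P := hH ▸ ha
        have hainv : a⁻¹ ∈ matrixEntries (invTranspose P) := by
          rwa [mem_matrixEntries_invTranspose, inv_inv]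
        have hQfin := finite_matrixEntries_invTranspose hfin'
        have hΛ : Finite Λ := by
          by_contra hΛ
          rw [not_finite_iff_infinite] at hΛ
          have := infinite_columns hP hr hc hfin' ha' ha1
          exact hgen (isOfGenericType hP hr hc hfin' ha' ha1)
        have hI : Finite I := by
          by_contra hI
          rw [not_finite_iff_infinite] at hI
          have := infinite_columns hP.invTranspose hc hr' hQfin hainv (inv_ne_one.2 ha1)
          exact not_finite Λ
        -- If `|Λ| < |I|`, the classification applies to the inverse transpose and yields `|I| =
        -- |Λ|`, a contradiction.
        have hle : Nat.card I ≤ Nat.card Λ := by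
          by_contra! hlt
          obtain ⟨H', hH'⟩ := exists_subgroup_eq_matrixEntries hP.invTranspose hc hr'
          have := (finite_classification_of_card_le hP.invTranspose hc hr' hlt.le hH'
            (a := a⁻¹) (by rwa [← SetLike.mem_coe, hH']) (inv_ne_one.2 ha1)).1
          omega
        exact (finite_classification_of_card_le hP hr hc hle hH ha ha1).2
      · left
        push Not at htriv
        exact Set.Subset.antisymm htriv (by rintro _ rfl; exact H.one_mem)
  · rintro ⟨hG, H, hH, hchar, hcases⟩
    have hET : EntryExtensible P oneI oneL ∧ EntryTransitive P oneI oneL := by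
      rcases hcases with h | ⟨-, -, hZ, a, ha, hM⟩ | ⟨-, -, hZ, a, ha, hM⟩ | ⟨-, -, hZ, a, ha, hM⟩
      · have h1 := (matrixEntries_eq_one_iff hP).1 (hH.symm.trans h)
        exact ⟨entryExtensible_of_eq_one h1, entryTransitive_of_eq_one h1⟩
      · exact entry_extensible_and_transitive_two hP hH hchar hZ ha hM
      · exact entry_extensible_and_transitive_three hP hchar hZ ha hM
      · exact entry_extensible_and_transitive_four hP hH hchar hZ ha hM
    exact ReesMatrixSemigroup.isHomogeneousCompletelyRegular hP hG hET.1 hET.2
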